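/- Let $k$ be a field of characteristic $0$ and let $S$ be a scheme over $k$ (a purely even base). A superscheme is a space with a sheaf of supercommutative rings $\mathcal O=\mathcal O_{0}\oplus\mathcal O_{1}$ such that the space with $\mathcal O_0$ is a scheme and $\mathcal O_1$ is a quasi-coherent $\mathcal O_0$-module. A smooth $1|2$-dimensional supercurve over $S$ is a superscheme $C\to S$ such that, locally on $C$ and $S$, $\mathcal O_C=A[\theta^1,\theta^2]$ with $A$ smooth of relative dimension $1$ over $\mathcal O_S$ and $\theta^1,\theta^2$ odd. For a commutative ring $R\supseteq\mathbb Q$ let $S(1|2)$ be the Lie superalgebra of divergence-free vector fields on $R[[z|\theta^1,\theta^2]]$, let $S(2)=[S(1|2),S(1|2)]$ be its derived algebra, and let $S(2)_+\subset S(2)$ consist of the even fields that map the ideal $\mathfrak m=\langle z,\theta^1,\theta^2\rangle$ into $\mathfrak m^2$. Let $\mathrm{Aut}^{\Delta}(R[[1|2]])$ be the set of automorphisms of the form $(z|\theta)\mapsto\exp(X)(T(z|\theta))$ with $X\in S(2)_+$ and $T$ an invertible linear change of coordinates of Berezinian $1$. An $S(2)$-supercurve over $S$ is a pair $(C,\Delta)$,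 where $C\to S$ is a smooth $1|2$-dimensional supercurve and $\Delta$ is a nonvanishing (even) section of $\mathrm{Ber}_{C/S}=\mathrm{Ber}(\Omega_{C/S})$, such that $C$ is covered by open sets $U_i$ with relative coordinates $(z_i|\theta_i^1,\theta_i^2)$ satisfying $\Delta|_{U_i}=[dz_i|d\theta_i^1d\theta_i^2]$ and whose changes of coordinates on $U_i\cap U_j$ lie in $\mathrm{Aut}^\Delta[[1|2]]$: at every point of $U_i\cap U_j$ with values in an affine $S$-scheme $\mathrm{Spec}\,R$, the $j$-th coordinates centred at the point, Taylor-expanded in the $i$-th coordinates centred at the point, define an element of $\mathrm{Aut}^\Delta(R[[1|2]])$. **Theorem.** Every $S(2)$-supercurve $(C,\Delta)$ over a purely even base $S$ is split: there exist a smooth curve $C_0\to S$ (a scheme smooth of relative dimension $1$), a rank-$2$ vector bundle $E$ on $C_0$ with $\det E\cong\omega_{C_0/S}$, and an isomorphism over $S$ $$C\;\cong\;\operatorname{Spec}\operatorname{Sym}_{\mathcal O_{C_0}}E[-1],$$ the right-hand side being the space $C_0$ with the sheaf of superalgebras freely generated over $\mathcal O_{C_0}$ by $E$ placed in odd degree.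 -/

import Mathlib

open CategoryTheory AlgebraicGeometry TopologicalSpace Opposite

universe u

noncomputable section

/-! ## The superalgebra `R[[z | θ¹, θ²]]`, its vector fields, and the group `Aut^Δ` -/

/-- `R[[1|2]] = R[[z]][θ¹, θ²]` for a commutative (purely even) ring `R`.  The element
`f₀ + f₁ θ¹ + f₂ θ² + f₃ θ¹ θ²` with `f₀, f₁, f₂, f₃ ∈ R[[z]]` is the family `![f₀, f₁, f₂, f₃]`. -/
def SuperSeries (R : Type u) [CommRing R] : Type u := Fin 4 → PowerSeries R

namespace SuperSeries

variable {R : Type u} [CommRing R]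

instance : AddCommGroup (SuperSeries R) := inferInstanceAs (AddCommGroup (Fin 4 → PowerSeries R))

instance : Module R (SuperSeries R) := inferInstanceAs (Module R (Fin 4 → PowerSeries R))

/-- The product, determined by `θ¹ θ² = - θ² θ¹` and `θⁱ θⁱ = 0`. -/
instance : Mul (SuperSeries R) where
  mul f g := ![f 0 * g 0, f 0 * g 1 + f 1 * g 0, f 0 * g 2 + f 2 * g 0,
    f 0 * g 3 + f 3 * g 0 + f 1 * g 2 - f 2 * g 1]

/-- The constant series `r ∈ R`. -/
def const (r : R) : SuperSeries R := ![PowerSeries.C r, 0, 0, 0]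

/-- The even coordinate `z`. -/
def z : SuperSeries R := ![PowerSeries.X, 0, 0, 0]

/-- The odd coordinates `θ¹ = theta 0` and `θ² = theta 1`. -/
def theta : Fin 2 → SuperSeries R := ![![0, 1, 0, 0], ![0, 0, 1, 0]]

/-- `f` is homogeneous of parity `i`. -/
def HasParity (i : ZMod 2) (f : SuperSeries R) : Prop :=
  (i = 0 → f 1 = 0 ∧ f 2 = 0) ∧ (i = 1 → f 0 = 0 ∧ f 3 = 0)

/-- The parity involution `f ↦ (-1)^{|f|} f`. -/
def parityInv (f : SuperSeries R) : SuperSeries R := ![f 0, -f 1, -f 2, f 3]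

/-- `∂/∂z`. -/
def dz (f : SuperSeries R) : SuperSeries R := fun I => PowerSeries.derivative R (f I)

/-- The (left) odd derivatives `∂/∂θ¹` and `∂/∂θ²`. -/
def dtheta : Fin 2 → SuperSeries R → SuperSeries R :=
  ![fun f => ![f 1, 0, f 3, 0], fun f => ![f 2, -f 3, 0, 0]]

/-- `f` lies in the square of the maximal ideal `⟨z, θ¹, θ²⟩` (relative to `R`). -/
def MemMaxSq (f : SuperSeries R) : Prop :=
  PowerSeries.X ^ 2 ∣ f 0 ∧ PowerSeries.X ∣ f 1 ∧ PowerSeries.X ∣ f 2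

end SuperSeries

/-- The vector field `A₀ ∂_z + A₁ ∂_{θ¹} + A₂ ∂_{θ²}` on `R[[1|2]]`, given by `![A₀, A₁, A₂]`. -/
def SuperField (R : Type u) [CommRing R] : Type u := Fin 3 → SuperSeries R

namespace SuperField

variable {R : Type u} [CommRing R]

instance : AddCommGroup (SuperField R) := inferInstanceAs (AddCommGroup (Fin 3 → SuperSeries R))

instance : Module R (SuperField R) := inferInstanceAs (Module R (Fin 3 → SuperSeries R))

/-- The action of a vector field on functions. -/
def act (A : SuperField R) (f : SuperSeries R) : SuperSeries R :=
  A 0 * SuperSeries.dz f + A 1 * SuperSeries.dtheta 0 f + A 2 * SuperSeries.dtheta 1 f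

/-- `A` is homogeneous of parity `i`. -/
def HasParity (i : ZMod 2) (A : SuperField R) : Prop :=
  (A 0).HasParity i ∧ (A 1).HasParity (i + 1) ∧ (A 2).HasParity (i + 1)

/-- The super divergence `∂_z A₀ + (-1)^{|A₁|} ∂_{θ¹} A₁ + (-1)^{|A₂|} ∂_{θ²} A₂`. -/
def sdiv (A : SuperField R) : SuperSeries R :=
  SuperSeries.dz (A 0) + SuperSeries.dtheta 0 (A 1).parityInv
    + SuperSeries.dtheta 1 (A 2).parityInv

/-- The coefficients of `[A, B] = A B - (-1)^{ij} B A`, for `A` of parity `i` and `B` of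
parity `j`. -/
def bracket (i j : ZMod 2) (A B : SuperField R) : SuperField R := fun m =>
  if i = 1 ∧ j = 1 then A.act (B m) + B.act (A m) else A.act (B m) - B.act (A m)

/-- The derived algebra `S(2) = [S(1|2), S(1|2)]` of the Lie superalgebra
`S(1|2) = {A | sdiv A = 0}`. -/
def S2 (R : Type u) [CommRing R] : Submodule R (SuperField R) :=
  Submodule.span R {D | ∃ (i j : ZMod 2) (A B : SuperField R), A.HasParity i ∧ B.HasParity j ∧
    A.sdiv = 0 ∧ B.sdiv = 0 ∧ D = bracket i j A B}

/-- The even fields of `S(2)₊`: those elements of `S(2)` that send the maximal ideal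
`⟨z, θ¹, θ²⟩` into its square. -/
def MemS2Plus (A : SuperField R) : Prop :=
  A ∈ S2 R ∧ A.HasParity 0 ∧ ∀ m, (A m).MemMaxSq

/-- `g = exp(A) f = ∑ₖ Aᵏ f / k!`, the series converging adically, i.e. each coefficient of the
partial sums being eventually that of `g`. -/
def IsExp (A : SuperField R) (f g : SuperSeries R) : Prop :=
  ∀ (I : Fin 4) (n : ℕ), ∀ᶠ N in Filter.atTop,
    PowerSeries.coeff n
      ((∑ k ∈ Finset.range N, Ring.inverse (k.factorial : R) • (A.act)^[k] f : SuperSeries R) I)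
      = PowerSeries.coeff n (g I)

end SuperField

/-- The automorphism `z ↦ w`, `θⁱ ↦ ρⁱ` of `R[[1|2]]` (`R` purely even) belongs to
`Aut^Δ(R[[1|2]])`: it has the form `(w | ρ) = exp(X)(T(z | θ))` with `X ∈ S(2)₊` and `T` an
invertible linear change of coordinates `z ↦ a z`, `θⁱ ↦ ∑ⱼ tᵢⱼ θʲ` of Berezinian
`a (det t)⁻¹ = 1`. -/
def MemAutDelta {R : Type u} [CommRing R] (w : SuperSeries R) (ρ : Fin 2 → SuperSeries R) : Prop :=
  ∃ (X : SuperField R) (a : R) (t : Matrix (Fin 2) (Fin 2) R) (gz : SuperSeries R)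
    (gθ : Fin 2 → SuperSeries R),
    X.MemS2Plus ∧ IsUnit a ∧ IsUnit t.det ∧ a * Ring.inverse t.det = 1 ∧
    X.IsExp SuperSeries.z gz ∧ (∀ i, X.IsExp (SuperSeries.theta i) (gθ i)) ∧
    w = a • gz ∧ ∀ i, ρ i = ∑ j, t i j • gθ j

/-! ## Superschemes -/

/-- A superscheme: a space with a sheaf `𝒪 = 𝒪₀ ⊕ 𝒪₁` of supercommutative rings such that the space
with `𝒪₀` is a scheme and `𝒪₁` is a quasi-coherent `𝒪₀`-module.  The field `mul` is the product of
odd sections. -/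
structure SuperScheme where
  /-- the underlying space with the sheaf `𝒪₀` -/
  even : Scheme.{u}
  /-- the sheaf `𝒪₁` -/
  odd : even.Modules
  quasicoherent : odd.IsQuasicoherent
  /-- the product `𝒪₁ × 𝒪₁ → 𝒪₀` -/
  mul (U : even.Opens) : Γ(odd, U) → Γ(odd, U) → Γ(even, U)
  mul_add (U : even.Opens) (x y y' : Γ(odd, U)) : mul U x (y + y') = mul U x y + mul U x y'
  mul_comm (U : even.Opens) (x y : Γ(odd, U)) : mul U x y = - mul U y x
  smul_mul (U : even.Opens) (a : Γ(even, U)) (x y : Γ(odd, U)) : mul U (a • x) y = a * mul U x y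
  mul_assoc (U : even.Opens) (x y t : Γ(odd, U)) : mul U x y • t = mul U y t • x
  mul_res {U V : even.Opens} (i : U ⟶ V) (x y : Γ(odd, V)) :
    even.presheaf.map i.op (mul V x y)
      = mul U (odd.presheaf.map i.op x) (odd.presheaf.map i.op y)

namespace SuperScheme

/-- Restriction of even sections. -/
def resE (C : SuperScheme.{u}) {W U : C.even.Opens} (h : W ≤ U) (a : Γ(C.even, U)) :
    Γ(C.even, W) := C.even.presheaf.map (homOfLE h).op a

/-- Restriction of odd sections. -/
def resO (C : SuperScheme.{u}) {W U : C.even.Opens} (h : W ≤ U) (x : Γ(C.odd, U)) :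
    Γ(C.odd, W) := C.odd.presheaf.map (homOfLE h).op x

/-- The product of the superalgebra `𝒪(U) = 𝒪₀(U) ⊕ 𝒪₁(U)`. -/
def mulSec (C : SuperScheme.{u}) (U : C.even.Opens) (s t : Γ(C.even, U) × Γ(C.odd, U)) :
    Γ(C.even, U) × Γ(C.odd, U) :=
  (s.1 * t.1 + C.mul U s.2 t.2, s.1 • t.2 + t.1 • s.2)

/-! ### Smooth families of `1|2`-dimensional supercurves over a purely even base

A purely even base is a scheme `S`.  As `𝒪_S` has no odd part, a morphism from a superscheme `C`
to `S` is a morphism of schemes `C.even ⟶ S`. -/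

variable {C : SuperScheme.{u}} {S : Scheme.{u}}

/-- `f : C → S` is a smooth family of supercurves of relative dimension `1|2`: locally on `C` and
`S` the superalgebra `𝒪_C(U)` is `A[θ¹, θ²]` for a smooth `𝒪_S(V)`-algebra `A` of relative
dimension `1`. -/
def IsSmoothCurve12 (f : C.even ⟶ S) : Prop :=
  ∀ x : C.even, ∃ (U : C.even.Opens) (V : S.Opens) (h : U ≤ f ⁻¹ᵁ V),
    x ∈ U ∧ IsAffineOpen U ∧ IsAffineOpen V ∧
    ∃ (A : CommRingCat.{u}) (φ : Γ(S, V) ⟶ A) (σ : A ⟶ Γ(C.even, U)) (θ : Fin 2 → Γ(C.odd, U)),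
      RingHom.IsStandardSmoothOfRelativeDimension 1 φ.hom ∧
      φ ≫ σ = f.appLE V U h ∧
      Function.Bijective (fun ab : A × A => σ ab.1 + σ ab.2 * C.mul U (θ 0) (θ 1)) ∧
      Function.Bijective (fun ab : A × A => σ ab.1 • θ 0 + σ ab.2 • θ 1)

/-- An even vector field on `U` relative to `S`: an even `𝒪_S`-linear derivation of the sheaf of
superalgebras `𝒪_C|_U`. -/
structure EvenField (f : C.even ⟶ S) (U : C.even.Opens) where
  d0 (W : C.even.Opens) (h : W ≤ U) : Γ(C.even, W) →+ Γ(C.even, W)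
  d1 (W : C.even.Opens) (h : W ≤ U) : Γ(C.odd, W) →+ Γ(C.odd, W)
  d0_res {W W' : C.even.Opens} (h : W ≤ U) (h' : W' ≤ W) (a : Γ(C.even, W)) :
    d0 W' (h'.trans h) (C.resE h' a) = C.resE h' (d0 W h a)
  d1_res {W W' : C.even.Opens} (h : W ≤ U) (h' : W' ≤ W) (x : Γ(C.odd, W)) :
    d1 W' (h'.trans h) (C.resO h' x) = C.resO h' (d1 W h x)
  d0_mul (W : C.even.Opens) (h : W ≤ U) (a b : Γ(C.even, W)) :
    d0 W h (a * b) = d0 W h a * b + a * d0 W h b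
  d1_smul (W : C.even.Opens) (h : W ≤ U) (a : Γ(C.even, W)) (x : Γ(C.odd, W)) :
    d1 W h (a • x) = d0 W h a • x + a • d1 W h x
  d0_mul_odd (W : C.even.Opens) (h : W ≤ U) (x y : Γ(C.odd, W)) :
    d0 W h (C.mul W x y) = C.mul W (d1 W h x) y + C.mul W x (d1 W h y)
  d0_base (W : C.even.Opens) (h : W ≤ U) (V : S.Opens) (hV : W ≤ f ⁻¹ᵁ V) (s : Γ(S, V)) :
    d0 W h (f.appLE V W hV s) = 0

/-- An odd vector field on `U` relative to `S`: an odd `𝒪_S`-linear derivation of the sheaf of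
superalgebras `𝒪_C|_U`, so that `D(ab) = D(a) b + (-1)^{|a|} a D(b)`. -/
structure OddField (f : C.even ⟶ S) (U : C.even.Opens) where
  d0 (W : C.even.Opens) (h : W ≤ U) : Γ(C.even, W) →+ Γ(C.odd, W)
  d1 (W : C.even.Opens) (h : W ≤ U) : Γ(C.odd, W) →+ Γ(C.even, W)
  d0_res {W W' : C.even.Opens} (h : W ≤ U) (h' : W' ≤ W) (a : Γ(C.even, W)) :
    d0 W' (h'.trans h) (C.resE h' a) = C.resO h' (d0 W h a)
  d1_res {W W' : C.even.Opens} (h : W ≤ U) (h' : W' ≤ W) (x : Γ(C.odd, W)) :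
    d1 W' (h'.trans h) (C.resO h' x) = C.resE h' (d1 W h x)
  d0_mul (W : C.even.Opens) (h : W ≤ U) (a b : Γ(C.even, W)) :
    d0 W h (a * b) = b • d0 W h a + a • d0 W h b
  d1_smul (W : C.even.Opens) (h : W ≤ U) (a : Γ(C.even, W)) (x : Γ(C.odd, W)) :
    d1 W h (a • x) = C.mul W (d0 W h a) x + a * d1 W h x
  d0_mul_odd (W : C.even.Opens) (h : W ≤ U) (x y : Γ(C.odd, W)) :
    d0 W h (C.mul W x y) = d1 W h x • y - d1 W h y • x
  d0_base (W : C.even.Opens) (h : W ≤ U) (V : S.Opens) (hV : W ≤ f ⁻¹ᵁ V) (s : Γ(S, V)) :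
    d0 W h (f.appLE V W hV s) = 0

/-- A system of coordinates `(z | θ¹, θ²)` on `U` relative to `S`: one even and two odd functions
on `U`, together with the vector fields `∂_z, ∂_{θ¹}, ∂_{θ²}` dual to them, which form a basis of
the relative tangent sheaf over `U`: every vector field `X` on an open subset is
`X(z) ∂_z + X(θ¹) ∂_{θ¹} + X(θ²) ∂_{θ²}`. -/
structure Coord (f : C.even ⟶ S) (U : C.even.Opens) where
  z : Γ(C.even, U)
  θ : Fin 2 → Γ(C.odd, U)
  dz : EvenField f U
  dθ : Fin 2 → OddField f U
  dz_z : dz.d0 U le_rfl z = 1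
  dz_θ (i : Fin 2) : dz.d1 U le_rfl (θ i) = 0
  dθ_z (i : Fin 2) : (dθ i).d0 U le_rfl z = 0
  dθ_θ (i j : Fin 2) : (dθ i).d1 U le_rfl (θ j) = if i = j then 1 else 0
  even_d0 (W : C.even.Opens) (h : W ≤ U) (X : EvenField f W) (W' : C.even.Opens) (h' : W' ≤ W)
    (a : Γ(C.even, W')) : X.d0 W' h' a
      = X.d0 W' h' (C.resE (h'.trans h) z) * dz.d0 W' (h'.trans h) a
        + ∑ i, C.mul W' (X.d1 W' h' (C.resO (h'.trans h) (θ i))) ((dθ i).d0 W' (h'.trans h) a)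
  even_d1 (W : C.even.Opens) (h : W ≤ U) (X : EvenField f W) (W' : C.even.Opens) (h' : W' ≤ W)
    (x : Γ(C.odd, W')) : X.d1 W' h' x
      = X.d0 W' h' (C.resE (h'.trans h) z) • dz.d1 W' (h'.trans h) x
        + ∑ i, (dθ i).d1 W' (h'.trans h) x • X.d1 W' h' (C.resO (h'.trans h) (θ i))
  odd_d0 (W : C.even.Opens) (h : W ≤ U) (X : OddField f W) (W' : C.even.Opens) (h' : W' ≤ W)
    (a : Γ(C.even, W')) : X.d0 W' h' a
      = dz.d0 W' (h'.trans h) a • X.d0 W' h' (C.resE (h'.trans h) z)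
        + ∑ i, X.d1 W' h' (C.resO (h'.trans h) (θ i)) • (dθ i).d0 W' (h'.trans h) a
  odd_d1 (W : C.even.Opens) (h : W ≤ U) (X : OddField f W) (W' : C.even.Opens) (h' : W' ≤ W)
    (x : Γ(C.odd, W')) : X.d1 W' h' x
      = C.mul W' (X.d0 W' h' (C.resE (h'.trans h) z)) (dz.d1 W' (h'.trans h) x)
        + ∑ i, X.d1 W' h' (C.resO (h'.trans h) (θ i)) * (dθ i).d1 W' (h'.trans h) x

/-- The Berezinian `det(A - B D⁻¹ C) det(D)⁻¹`, over `W`, of the Jacobian matrix of the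
coordinates `ψ = (w | ρ¹, ρ²)` with respect to the coordinates `φ = (z | θ¹, θ²)`, where
`A = ∂_z w`, `B = (∂_z ρʲ)`, `C = (∂_{θⁱ} w)` and `D = (∂_{θⁱ} ρʲ)`. -/
def berJacobian {f : C.even ⟶ S} {U U' : C.even.Opens} (φ : Coord f U) (ψ : Coord f U')
    (W : C.even.Opens) (h : W ≤ U) (h' : W ≤ U') : Γ(C.even, W) :=
  let w := C.resE h' ψ.z
  let ρ : Fin 2 → Γ(C.odd, W) := fun j => C.resO h' (ψ.θ j)
  let D : Matrix (Fin 2) (Fin 2) Γ(C.even, W) := Matrix.of fun i j => (φ.dθ i).d1 W h (ρ j)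
  (φ.dz.d0 W h w
    - ∑ j, ∑ k, D⁻¹ j k * C.mul W (φ.dz.d1 W h (ρ j)) ((φ.dθ k).d0 W h w)) * Ring.inverse D.det

/-- A nonvanishing section `Δ` of the Berezinian sheaf `Ber_{C/S}` of `Ω_{C/S}`: in each system of
coordinates `φ = (z | θ¹, θ²)` it is `Δ = f_φ [dz | dθ¹ dθ²]` with an invertible function `f_φ`,
and `[dw | dρ¹ dρ²] = Ber(∂(w | ρ)/∂(z | θ)) [dz | dθ¹ dθ²]`. -/
structure BerSection (f : C.even ⟶ S) where
  coeff (U : C.even.Opens) (φ : Coord f U) : Γ(C.even, U)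
  isUnit_coeff (U : C.even.Opens) (φ : Coord f U) : IsUnit (coeff U φ)
  coeff_eq (U U' : C.even.Opens) (φ : Coord f U) (ψ : Coord f U') (W : C.even.Opens)
    (h : W ≤ U) (h' : W ≤ U') :
    C.resE h (coeff U φ) = C.resE h' (coeff U' ψ) * berJacobian φ ψ W h h'

/-- The coordinates `(z | θ¹, θ²)` are compatible with `Δ`: `Δ = [dz | dθ¹ dθ²]`. -/
def Coord.IsCompatible {f : C.even ⟶ S} {U : C.even.Opens} (φ : Coord f U) (Δ : BerSection f) :
    Prop := Δ.coeff U φ = 1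

/-- A morphism `p : T ⟶ C.even` from a scheme `T` is a morphism of superschemes from the purely
even superscheme `T` to `C`, i.e. a `T`-valued point of `C`: it kills the products of odd
functions. -/
def IsPoint {T : Scheme.{u}} (p : T ⟶ C.even) : Prop :=
  ∀ (W : C.even.Opens) (x y : Γ(C.odd, W)), p.app W (C.mul W x y) = 0

/-- The Taylor expansion in `R[[z | θ¹, θ²]]`, `R = 𝒪(T)`, of an even function `a` at the
`T`-valued point `p` in the coordinates `φ`. -/
def taylorEven {f : C.even ⟶ S} {U : C.even.Opens} (φ : Coord f U) {T : Scheme.{u}}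
    (p : T ⟶ C.even) (W : C.even.Opens) (h : W ≤ U) (hp : (⊤ : T.Opens) ≤ p ⁻¹ᵁ W)
    (a : Γ(C.even, W)) : SuperSeries Γ(T, ⊤) :=
  ![PowerSeries.mk fun n =>
      Ring.inverse (n.factorial : Γ(T, ⊤)) * p.appLE W ⊤ hp ((φ.dz.d0 W h)^[n] a),
    0, 0,
    PowerSeries.mk fun n =>
      Ring.inverse (n.factorial : Γ(T, ⊤)) * p.appLE W ⊤ hp
        ((φ.dz.d0 W h)^[n] ((φ.dθ 1).d1 W h ((φ.dθ 0).d0 W h a)))]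

/-- The Taylor expansion in `R[[z | θ¹, θ²]]`, `R = 𝒪(T)`, of an odd function `x` at the `T`-valued
point `p` in the coordinates `φ`. -/
def taylorOdd {f : C.even ⟶ S} {U : C.even.Opens} (φ : Coord f U) {T : Scheme.{u}}
    (p : T ⟶ C.even) (W : C.even.Opens) (h : W ≤ U) (hp : (⊤ : T.Opens) ≤ p ⁻¹ᵁ W)
    (x : Γ(C.odd, W)) : SuperSeries Γ(T, ⊤) :=
  ![0,
    PowerSeries.mk fun n =>
      Ring.inverse (n.factorial : Γ(T, ⊤)) * p.appLE W ⊤ hp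
        ((φ.dz.d0 W h)^[n] ((φ.dθ 0).d1 W h x)),
    PowerSeries.mk fun n =>
      Ring.inverse (n.factorial : Γ(T, ⊤)) * p.appLE W ⊤ hp
        ((φ.dz.d0 W h)^[n] ((φ.dθ 1).d1 W h x)),
    0]

/-- The change of coordinates from `φ` to `ψ` belongs to `Aut^Δ[[1|2]]`: at every `T`-valued point
`p` (`T` affine) of the common domain, the coordinates `ψ`, centred at `p` and expanded in the
coordinates `φ` centred at `p`, form an element of `Aut^Δ(R[[1|2]])` with `R = 𝒪(T)`. -/
def ChangeInAutDelta {f : C.even ⟶ S} {U U' : C.even.Opens} (φ : Coord f U) (ψ : Coord f U') :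
    Prop :=
  ∀ (T : Scheme.{u}) [IsAffine T] (p : T ⟶ C.even), IsPoint p →
    ∀ hp : (⊤ : T.Opens) ≤ p ⁻¹ᵁ (U ⊓ U'),
    MemAutDelta
      (taylorEven φ p (U ⊓ U') inf_le_left hp (C.resE inf_le_right ψ.z)
        - SuperSeries.const (p.appLE (U ⊓ U') ⊤ hp (C.resE inf_le_right ψ.z)))
      (fun i => taylorOdd φ p (U ⊓ U') inf_le_left hp (C.resO inf_le_right (ψ.θ i)))

/-- `(C, Δ)` is an `S(2)`-supercurve over `S`: `C → S` is a smooth family of supercurves of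
dimension `1|2`, and `C` is covered by systems of coordinates compatible with `Δ` whose changes of
coordinates belong to `Aut^Δ[[1|2]]`. -/
def IsS2Curve (f : C.even ⟶ S) (Δ : BerSection f) : Prop :=
  IsSmoothCurve12 f ∧
  ∃ (ι : Type u) (U : ι → C.even.Opens) (φ : ∀ i, Coord f (U i)),
    (⨆ i, U i) = ⊤ ∧ (∀ i, (φ i).IsCompatible Δ) ∧ ∀ i j, ChangeInAutDelta (φ i) (φ j)

end SuperScheme

/-! ## Rank two bundles, their determinants, and split supercurves -/

section Bundle

variable {X S : Scheme.{u}}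

/-- The sections `e 0, e 1` trivialize `E` over `U`. -/
def IsFrame (E : X.Modules) (U : X.Opens) (e : Fin 2 → Γ(E, U)) : Prop :=
  ∀ (W : X.Opens) (h : W ≤ U), Function.Bijective (fun ab : Γ(X, W) × Γ(X, W) =>
    ab.1 • E.presheaf.map (homOfLE h).op (e 0) + ab.2 • E.presheaf.map (homOfLE h).op (e 1))

/-- `E` is trivial of rank two over `U`. -/
def IsTrivialOn (E : X.Modules) (U : X.Opens) : Prop := ∃ e : Fin 2 → Γ(E, U), IsFrame E U e

/-- `E` is a vector bundle of rank two. -/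
def IsRankTwoBundle (E : X.Modules) : Prop := ∀ x : X, ∃ U : X.Opens, x ∈ U ∧ IsTrivialOn E U

lemma appLE_res_comm (g : X ⟶ S) {U U' : X.Opens} {V V' : S.Opens} (h : U ≤ g ⁻¹ᵁ V)
    (h' : U' ≤ g ⁻¹ᵁ V') (hU : U' ≤ U) (hV : V' ≤ V) :
    S.presheaf.map (homOfLE hV).op ≫ g.appLE V' U' h'
      = g.appLE V U h ≫ X.presheaf.map (homOfLE hU).op := by
  rw [Scheme.Hom.map_appLE, Scheme.Hom.appLE_map]

/-- The affine open sets `U` of `X` that lie over the affine open set `V` of `S` and on which `E`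
is trivial. -/
structure IsGoodPair (g : X ⟶ S) (E : X.Modules) (U : X.Opens) (V : S.Opens) : Prop where
  affU : IsAffineOpen U
  affV : IsAffineOpen V
  le : U ≤ g ⁻¹ᵁ V
  trivial : IsTrivialOn E U

/-- An isomorphism `det E ≅ ω_{X/S} = Ω_{X/S}` for a rank two bundle `E` on a smooth curve
`g : X ⟶ S`, given by compatible isomorphisms of the modules of sections on the basis of the affine
open sets that lie over an affine open set of `S` and trivialize `E`. -/
structure DetIso (g : X ⟶ S) (E : X.Modules) where
  iso (U : X.Opens) (V : S.Opens) (H : IsGoodPair g E U V) :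
    (⋀[Γ(X, U)]^2 Γ(E, U)) ≃ₗ[Γ(X, U)] CommRingCat.KaehlerDifferential (g.appLE V U H.le)
  iso_res (U U' : X.Opens) (V V' : S.Opens) (H : IsGoodPair g E U V) (H' : IsGoodPair g E U' V')
    (hU : U' ≤ U) (hV : V' ≤ V) (e : Fin 2 → Γ(E, U)) :
    iso U' V' H' (exteriorPower.ιMulti Γ(X, U') 2 fun i => E.presheaf.map (homOfLE hU).op (e i))
      = (CommRingCat.KaehlerDifferential.map (appLE_res_comm g H.le H'.le hU hV)).hom
          (iso U V H (exteriorPower.ιMulti Γ(X, U) 2 e))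

/-- An isomorphism `C ≅ Spec Sym_{𝒪_X} E[-1]` of superschemes, for a scheme `X` and a rank two
bundle `E` on `X`.  The superscheme on the right is the space `X` with the sheaf of superalgebras
freely generated over `𝒪_X` by `E` placed in odd degree, that is, the exterior algebra of `E`.
The isomorphism is a homeomorphism `p` together with an isomorphism of this sheaf with `p_* 𝒪_C`;
the latter is given by its restrictions `p^♯` to `𝒪_X` and `inc` to `E`, and is required to be
bijective on the basis of the affine open sets on which `E` is trivial. -/
structure SplitIso (C : SuperScheme.{u}) (X : Scheme.{u}) (E : X.Modules) where
  p : C.even ⟶ X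
  homeo : IsHomeomorph p
  /-- the inclusion of `E` as the odd part of `p_* 𝒪_C` -/
  inc (U : X.Opens) : Γ(E, U) →+ Γ(C.odd, p ⁻¹ᵁ U)
  inc_res {U U' : X.Opens} (h : U' ≤ U) (e : Γ(E, U)) :
    inc U' (E.presheaf.map (homOfLE h).op e)
      = C.resO (show p ⁻¹ᵁ U' ≤ p ⁻¹ᵁ U from fun _ hx => h hx) (inc U e)
  inc_smul (U : X.Opens) (r : Γ(X, U)) (e : Γ(E, U)) : inc U (r • e) = p.app U r • inc U e
  bijective (U : X.Opens) (hU : IsAffineOpen U) (hE : IsTrivialOn E U) :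
    ∃ Ψ : ExteriorAlgebra Γ(X, U) Γ(E, U) ≃+ Γ(C.even, p ⁻¹ᵁ U) × Γ(C.odd, p ⁻¹ᵁ U),
      (∀ r, Ψ (algebraMap _ _ r) = (p.app U r, 0)) ∧
      (∀ e, Ψ (ExteriorAlgebra.ι _ e) = (0, inc U e)) ∧
      ∀ x y, Ψ (x * y) = C.mulSec (p ⁻¹ᵁ U) (Ψ x) (Ψ y)

end Bundle

end

/-! For a divergence-free field the coefficient of `θ¹θ² ∂_z` is constant in `z`, and this
coefficient cancels in every bracket (`bracket_zero_three`). Hence an even field of `S(2)` has a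
`∂_z`-coefficient depending on `z` alone, its exponential sends `z` to a series in `z` alone, and so
does every element of `Aut^Δ` (`MemAutDelta.isBody`). Applied at the points of the closed subscheme
`C₀` cut out by all products of odd functions, this shows that the even coordinate of each chart has
no `θ¹θ²`-term in any other chart (`Coord.isBody_of_changeInAutDelta`).

In a chart every even function is uniquely `b + c θ¹θ²` with `b`, `c` killed by both `∂_θ`; call
such functions body functions. A body function is determined by its restriction to `C₀`, and every
function on `C₀` is locally such a restriction. Since being a body function does not depend on the
chart, these local lifts glue to a ring-theoretic section of restriction (`SplitAtlas.lift`), and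
this defines a retraction `proj : C → C₀` over `S`. The odd functions, pushed forward along `proj`,
form the rank two bundle `E` with local frames `θ¹, θ²`, and multiplication identifies its exterior
algebra with the functions on `C` (`bijective_exteriorHom`).

For the determinant: as the new even coordinate `w` does not involve `θ`, the Jacobian is block
triangular and its Berezinian is `∂_z w / det D`. Compatibility with `Δ` makes it `1`, so `ρ¹ρ² =
∂_z w · θ¹θ²`, and `r ↦ ∂_z r · θ¹θ²` is a derivation independent of the chart
(`Coord.dz_mul_vol_eq`, `dvol`). Over good affine open sets both `Ω` and `⋀² E` thereby embed into
the even functions with the same image, the functions vanishing on `C₀`; this is the isomorphism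
(`range_wedgeMap`, `range_kaehlerMap`, `exists_detEquiv`). -/

noncomputable section

/-! ### The Lie superalgebra `S(2)` and the even coordinate under `Aut^Δ` -/

namespace SuperSeries

variable {R : Type u} [CommRing R]

@[simp] lemma mul_apply_one (f g : SuperSeries R) : (f * g) 1 = f 0 * g 1 + f 1 * g 0 := rfl
@[simp] lemma mul_apply_two (f g : SuperSeries R) : (f * g) 2 = f 0 * g 2 + f 2 * g 0 := rfl
@[simp] lemma mul_apply_three (f g : SuperSeries R) :
    (f * g) 3 = f 0 * g 3 + f 3 * g 0 + f 1 * g 2 - f 2 * g 1 := rfl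
@[simp] lemma add_apply (f g : SuperSeries R) (I : Fin 4) : (f + g) I = f I + g I := rfl
@[simp] lemma sub_apply (f g : SuperSeries R) (I : Fin 4) : (f - g) I = f I - g I := rfl
@[simp] lemma zero_apply (I : Fin 4) : (0 : SuperSeries R) I = 0 := rfl
@[simp] lemma smul_apply (r : R) (f : SuperSeries R) (I : Fin 4) : (r • f) I = r • f I := rfl
@[simp] lemma dz_apply (f : SuperSeries R) (I : Fin 4) :
    dz f I = PowerSeries.derivative R (f I) := rfl
@[simp] lemma dtheta_zero_zero (f : SuperSeries R) : dtheta 0 f 0 = f 1 := rfl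
@[simp] lemma dtheta_zero_one (f : SuperSeries R) : dtheta 0 f 1 = 0 := rfl
@[simp] lemma dtheta_zero_two (f : SuperSeries R) : dtheta 0 f 2 = f 3 := rfl
@[simp] lemma dtheta_zero_three (f : SuperSeries R) : dtheta 0 f 3 = 0 := rfl
@[simp] lemma dtheta_one_zero (f : SuperSeries R) : dtheta 1 f 0 = f 2 := rfl
@[simp] lemma dtheta_one_one (f : SuperSeries R) : dtheta 1 f 1 = -f 3 := rfl
@[simp] lemma dtheta_one_two (f : SuperSeries R) : dtheta 1 f 2 = 0 := rfl
@[simp] lemma dtheta_one_three (f : SuperSeries R) : dtheta 1 f 3 = 0 := rfl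
@[simp] lemma parityInv_one (f : SuperSeries R) : parityInv f 1 = -f 1 := rfl
@[simp] lemma parityInv_two (f : SuperSeries R) : parityInv f 2 = -f 2 := rfl
@[simp] lemma parityInv_three (f : SuperSeries R) : parityInv f 3 = f 3 := rfl

/-- The series is a function of the even coordinate only. -/
def IsBody (f : SuperSeries R) : Prop := f 1 = 0 ∧ f 2 = 0 ∧ f 3 = 0

lemma sum_apply {ι : Type*} (s : Finset ι) (f : ι → SuperSeries R) (I : Fin 4) :
    (∑ i ∈ s, f i) I = ∑ i ∈ s, f i I :=
  Finset.sum_apply I s f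

end SuperSeries

namespace SuperField

variable {R : Type u} [CommRing R]

/-- The `θ¹θ²`-component of the `∂_z`-coefficient vanishes on brackets of divergence-free fields. -/
lemma bracket_zero_three {i j : ZMod 2} {A B : SuperField R} (hA : A.HasParity i)
    (hB : B.HasParity j) (dA : A.sdiv = 0) (dB : B.sdiv = 0) : bracket i j A B 0 3 = 0 := by
  have dA0 := congrFun dA 0
  have dA1 := congrFun dA 1
  have dA2 := congrFun dA 2
  have dA3 := congrFun dA 3
  have dB0 := congrFun dB 0
  have dB1 := congrFun dB 1
  have dB2 := congrFun dB 2
  have dB3 := congrFun dB 3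
  obtain ⟨⟨a1, a2⟩, ⟨a3, a4⟩, ⟨a5, a6⟩⟩ := hA
  obtain ⟨⟨b1, b2⟩, ⟨b3, b4⟩, ⟨b5, b6⟩⟩ := hB
  simp [sdiv] at dA0 dA1 dA2 dA3 dB0 dB1 dB2 dB3
  have key : ∀ k : ZMod 2, k = 0 ∨ k = 1 := by decide
  have e10 : (1 : ZMod 2) + 1 = 0 := by decide
  -- For mixed parities the bracket is odd, so the component vanishes. For two even fields the
  -- component of `A(B₀)` is `a₃ b₀' + a₀' b₃`, symmetric in `A` and `B`, and the bracket is a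
  -- difference. For two odd fields it is `(a₁ b₂ - a₂ b₁)'`, antisymmetric, and the bracket is a
  -- sum.
  rcases key i with rfl | rfl <;> rcases key j with rfl | rfl <;>
  simp only [zero_add, e10, true_implies, zero_ne_one, one_ne_zero,
    false_implies] at a1 a2 a3 a4 a5 a6 b1 b2 b3 b4 b5 b6 <;>
  simp [bracket, act, *] at * <;>
  grind

lemma zero_three_of_mem_S2 {A : SuperField R} (hA : A ∈ S2 R) : A 0 3 = 0 := by
  induction hA using Submodule.span_induction with
  | mem D h =>
    obtain ⟨i, j, A, B, hA, hB, dA, dB, rfl⟩ := h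
    exact bracket_zero_three hA hB dA dB
  | zero => rfl
  | add A B _ _ hA hB =>
    change A 0 3 + B 0 3 = 0
    rw [hA, hB, add_zero]
  | smul r A _ hA =>
    change r • A 0 3 = 0
    rw [hA, smul_zero]

/-- Both `∂_θ` kill a series in `z`, so only `A₀ ∂_z` acts on it; the coefficients of `∂_θ` may be
arbitrary. -/
lemma isBody_act {A : SuperField R} (hA : (A 0).IsBody) {f : SuperSeries R} (hf : f.IsBody) :
    (A.act f).IsBody := by
  obtain ⟨a1, a2, a3⟩ := hA
  obtain ⟨f1, f2, f3⟩ := hf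
  simp [SuperSeries.IsBody, act, *]

lemma isBody_of_isExp {A : SuperField R} (hA : (A 0).IsBody) {f g : SuperSeries R}
    (hf : f.IsBody) (h : A.IsExp f g) : g.IsBody := by
  have hk (k : ℕ) : ((A.act)^[k] f).IsBody := by
    induction k with
    | zero => exact hf
    | succ k ih => rw [Function.iterate_succ_apply']; exact isBody_act hA ih
  have aux (I : Fin 4) (hI : ∀ k, (A.act)^[k] f I = 0) : g I = 0 := by
    ext n
    obtain ⟨N, hN⟩ := (h I n).exists
    rw [← hN, SuperSeries.sum_apply]
    simp [hI]
  exact ⟨aux 1 fun k => (hk k).1, aux 2 fun k => (hk k).2.1, aux 3 fun k => (hk k).2.2⟩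

end SuperField

/-- Under an automorphism in `Aut^Δ` the even coordinate is sent to a function of `z` only. -/
lemma MemAutDelta.isBody {R : Type u} [CommRing R] {w : SuperSeries R} {ρ : Fin 2 → SuperSeries R}
    (h : MemAutDelta w ρ) : w.IsBody := by
  obtain ⟨X, a, t, gz, gθ, ⟨hX, hX0, -⟩, -, -, -, hz, -, rfl, -⟩ := h
  have hb : (X 0).IsBody :=
    ⟨(hX0.1.1 rfl).1, (hX0.1.1 rfl).2, SuperField.zero_three_of_mem_S2 hX⟩
  obtain ⟨h1, h2, h3⟩ := SuperField.isBody_of_isExp hb (f := SuperSeries.z) ⟨rfl, rfl, rfl⟩ hz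
  simp [SuperSeries.IsBody, *]

/-! ### Extension of sections of quasi-coherent modules -/

namespace AlgebraicGeometry

variable {X : Scheme.{u}}

lemma Scheme.presheaf_map_map (X : Scheme.{u}) {U V W : X.Opensᵒᵖ} (i : U ⟶ V) (j : V ⟶ W)
    (l : U ⟶ W) (a : X.presheaf.obj U) :
    X.presheaf.map j (X.presheaf.map i a) = X.presheaf.map l a := by
  rw [← ConcreteCategory.comp_apply, ← Functor.map_comp]
  rfl

lemma Scheme.Modules.presheaf_map_map (M : X.Modules) {U V W : X.Opensᵒᵖ} (i : U ⟶ V) (j : V ⟶ W)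
    (l : U ⟶ W) (a : M.presheaf.obj U) :
    M.presheaf.map j (M.presheaf.map i a) = M.presheaf.map l a := by
  rw [← ConcreteCategory.comp_apply, ← Functor.map_comp]
  rfl

lemma IsAffineOpen.ΓSpecIso_inv_map_appIso_inv {U : X.Opens} (hU : IsAffineOpen U)
    (W : (Spec Γ(X, U)).Opens) (h : hU.fromSpec ''ᵁ W ≤ U) :
    (Scheme.ΓSpecIso Γ(X, U)).inv ≫ (Spec Γ(X, U)).presheaf.map W.leTop.op ≫
      (hU.fromSpec.appIso W).inv = X.presheaf.map (homOfLE h).op := by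
  rw [← Category.assoc, Iso.comp_inv_eq, Scheme.Hom.appIso_hom, ← Category.assoc,
    Scheme.Hom.naturality, Category.assoc, hU.fromSpec_app_self, Category.assoc, ← Functor.map_comp,
    ← Functor.map_comp]
  rfl

/-- A section of a quasi-coherent module over a basic open set of an affine open set extends after
multiplication by a power of the function defining it. -/
lemma Scheme.Modules.exists_res_eq_pow_smul (M : X.Modules) [M.IsQuasicoherent] {U : X.Opens}
    (hU : IsAffineOpen U) (f : Γ(X, U)) (x : Γ(M, X.basicOpen f)) :
    ∃ (n : ℕ) (y : Γ(M, U)), M.presheaf.map (homOfLE (X.basicOpen_le f)).op y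
      = X.presheaf.map (homOfLE (X.basicOpen_le f)).op f ^ n • x := by
  let j := hU.fromSpec
  -- On the affine scheme `Spec Γ(X, U)` a quasi-coherent module comes from a module, so its
  -- sections over `D(f)` are a localization. What remains is transport along `fromSpec`.
  have hloc : IsLocalizing (modulesSpecToSheaf.obj (M.restrict j)) :=
    (isIso_fromTildeΓ_iff_isLocalizing _).1 inferInstance
  have hf : j ''ᵁ PrimeSpectrum.basicOpen f = X.basicOpen f := hU.fromSpec_image_basicOpen f
  have htop : j ''ᵁ ⊤ = U := by
    rw [Scheme.Hom.image_top_eq_opensRange]; exact hU.opensRange_fromSpec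
  let x' : Γ(M.restrict j, PrimeSpectrum.basicOpen f) := M.presheaf.map (eqToHom hf).op x
  obtain ⟨⟨y, ⟨_, n, rfl⟩⟩, hy⟩ := (hloc f).surj x'
  refine ⟨n, M.presheaf.map (eqToHom htop.symm).op (y : Γ(M, j ''ᵁ ⊤)), ?_⟩
  have hle : j ''ᵁ PrimeSpectrum.basicOpen f ≤ U := hf.trans_le (X.basicOpen_le f)
  have h1 : M.presheaf.map (homOfLE (show j ''ᵁ PrimeSpectrum.basicOpen f ≤ j ''ᵁ ⊤ from
      Scheme.Hom.image_mono _ le_top)).op (y : Γ(M, j ''ᵁ ⊤))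
      = X.presheaf.map (homOfLE hle).op (f ^ n) • M.presheaf.map (eqToHom hf).op x := by
    rw [← hU.ΓSpecIso_inv_map_appIso_inv _ hle]
    exact hy.symm
  have h2 := congrArg (M.presheaf.map (eqToHom hf.symm).op) h1
  rw [Scheme.Modules.map_smul] at h2
  have h3 : M.presheaf.map (eqToHom hf.symm).op (M.presheaf.map (eqToHom hf).op x) = x := by
    rw [← ConcreteCategory.comp_apply, ← Functor.map_comp,
      show (eqToHom hf).op ≫ (eqToHom hf.symm).op = 𝟙 _ from Subsingleton.elim _ _,
      CategoryTheory.Functor.map_id]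
    rfl
  rw [h3] at h2
  rw [← map_pow]
  refine Eq.trans ?_ (h2.trans (congrArg (· • x) (X.presheaf_map_map _ _ _ _)))
  exact (M.presheaf_map_map _ _ (homOfLE (hf.ge.trans (Scheme.Hom.image_mono _ le_top))).op y).trans
    (M.presheaf_map_map _ _ _ y).symm

end AlgebraicGeometry

/-! ### Calculus of functions and vector fields in a chart -/

namespace SuperScheme

variable {C : SuperScheme.{u}} {S : Scheme.{u}} {f : C.even ⟶ S}

section Sections

variable {W U V : C.even.Opens}

@[simp] lemma resE_add (h : W ≤ U) (a b : Γ(C.even, U)) :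
    C.resE h (a + b) = C.resE h a + C.resE h b := map_add _ _ _
@[simp] lemma resE_sub (h : W ≤ U) (a b : Γ(C.even, U)) :
    C.resE h (a - b) = C.resE h a - C.resE h b := map_sub _ _ _
@[simp] lemma resE_mul (h : W ≤ U) (a b : Γ(C.even, U)) :
    C.resE h (a * b) = C.resE h a * C.resE h b := map_mul _ _ _
@[simp] lemma resE_zero (h : W ≤ U) : C.resE h (0 : Γ(C.even, U)) = 0 := map_zero _
@[simp] lemma resE_one (h : W ≤ U) : C.resE h (1 : Γ(C.even, U)) = 1 := map_one _
@[simp] lemma resO_add (h : W ≤ U) (a b : Γ(C.odd, U)) :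
    C.resO h (a + b) = C.resO h a + C.resO h b := map_add _ _ _
@[simp] lemma resO_zero (h : W ≤ U) : C.resO h (0 : Γ(C.odd, U)) = 0 := map_zero _
@[simp] lemma resO_smul (h : W ≤ U) (a : Γ(C.even, U)) (x : Γ(C.odd, U)) :
    C.resO h (a • x) = C.resE h a • C.resO h x := Scheme.Modules.map_smul _ _ _ _
@[simp] lemma resE_oddMul (h : W ≤ U) (x y : Γ(C.odd, U)) :
    C.resE h (C.mul U x y) = C.mul W (C.resO h x) (C.resO h y) := C.mul_res _ _ _
@[simp] lemma resE_resE (h : W ≤ U) (h' : U ≤ V) (a : Γ(C.even, V)) :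
    C.resE h (C.resE h' a) = C.resE (h.trans h') a := by
  simp only [resE, ← ConcreteCategory.comp_apply, ← Functor.map_comp]; rfl
@[simp] lemma resO_resO (h : W ≤ U) (h' : U ≤ V) (a : Γ(C.odd, V)) :
    C.resO h (C.resO h' a) = C.resO (h.trans h') a := by
  simp only [resO, ← ConcreteCategory.comp_apply, ← Functor.map_comp]; rfl
@[simp] lemma resE_self (h : W ≤ W) (a : Γ(C.even, W)) : C.resE h a = a := by
  change C.even.presheaf.map (𝟙 _) a = a
  simp
@[simp] lemma resO_self (h : W ≤ W) (a : Γ(C.odd, W)) : C.resO h a = a := by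
  change C.odd.presheaf.map (𝟙 _) a = a
  simp

@[simp] lemma oddMul_add (x y y' : Γ(C.odd, U)) :
    C.mul U x (y + y') = C.mul U x y + C.mul U x y' := C.mul_add U x y y'
@[simp] lemma oddAdd_mul (x x' y : Γ(C.odd, U)) :
    C.mul U (x + x') y = C.mul U x y + C.mul U x' y := by
  rw [C.mul_comm, C.mul_add, C.mul_comm U x, C.mul_comm U x']; ring
@[simp] lemma smul_oddMul (a : Γ(C.even, U)) (x y : Γ(C.odd, U)) :
    C.mul U (a • x) y = a * C.mul U x y := C.smul_mul U a x y
@[simp] lemma oddMul_smul (a : Γ(C.even, U)) (x y : Γ(C.odd, U)) :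
    C.mul U x (a • y) = a * C.mul U x y := by
  rw [C.mul_comm, C.smul_mul, C.mul_comm U x]; ring
@[simp] lemma oddMul_zero (x : Γ(C.odd, U)) : C.mul U x 0 = 0 := by
  rw [C.mul_comm, ← zero_smul Γ(C.even, U) (0 : Γ(C.odd, U)), C.smul_mul, zero_mul, neg_zero]
@[simp] lemma zero_oddMul (x : Γ(C.odd, U)) : C.mul U 0 x = 0 := by
  rw [C.mul_comm, oddMul_zero, neg_zero]

end Sections

/-- The restriction of an even vector field. -/
@[simps]
def EvenField.restrict {U V : C.even.Opens} (X : EvenField f U) (hV : V ≤ U) : EvenField f V where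
  d0 W h := X.d0 W (h.trans hV)
  d1 W h := X.d1 W (h.trans hV)
  d0_res _ h' a := X.d0_res _ h' a
  d1_res _ h' a := X.d1_res _ h' a
  d0_mul W _ := X.d0_mul W _
  d1_smul W _ := X.d1_smul W _
  d0_mul_odd W _ := X.d0_mul_odd W _
  d0_base W _ := X.d0_base W _

/-- The restriction of an odd vector field. -/
@[simps]
def OddField.restrict {U V : C.even.Opens} (X : OddField f U) (hV : V ≤ U) : OddField f V where
  d0 W h := X.d0 W (h.trans hV)
  d1 W h := X.d1 W (h.trans hV)
  d0_res _ h' a := X.d0_res _ h' a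
  d1_res _ h' a := X.d1_res _ h' a
  d0_mul W _ := X.d0_mul W _
  d1_smul W _ := X.d1_smul W _
  d0_mul_odd W _ := X.d0_mul_odd W _
  d0_base W _ := X.d0_base W _

/-- The bracket `D D' + D' D` of two odd vector fields. -/
@[simps]
def OddField.bracket {U : C.even.Opens} (D D' : OddField f U) : EvenField f U where
  d0 W h := (D.d1 W h).comp (D'.d0 W h) + (D'.d1 W h).comp (D.d0 W h)
  d1 W h := (D.d0 W h).comp (D'.d1 W h) + (D'.d0 W h).comp (D.d1 W h)
  d0_res h h' a := by simp [D.d0_res h h', D'.d0_res h h', D.d1_res h h', D'.d1_res h h']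
  d1_res h h' a := by simp [D.d0_res h h', D'.d0_res h h', D.d1_res h h', D'.d1_res h h']
  d0_mul W h a b := by
    simp only [AddMonoidHom.add_apply, AddMonoidHom.comp_apply, d0_mul, map_add, d1_smul]
    rw [C.mul_comm W (D.d0 W h b), C.mul_comm W (D.d0 W h a)]
    ring
  d1_smul W h a x := by
    simp only [AddMonoidHom.add_apply, AddMonoidHom.comp_apply, d0_mul, map_add, d1_smul,
      d0_mul_odd]
    module
  d0_mul_odd W h x y := by
    simp only [AddMonoidHom.add_apply, AddMonoidHom.comp_apply, map_sub, d1_smul,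
      d0_mul_odd, oddAdd_mul, oddMul_add]
    rw [C.mul_comm W (D.d0 W h _) x, C.mul_comm W (D'.d0 W h _) x]
    ring
  d0_base W h V hV s := by simp [D.d0_base W h V hV, D'.d0_base W h V hV]

@[simp] lemma OddField.d0_one {U : C.even.Opens} (X : OddField f U) (W : C.even.Opens)
    (h : W ≤ U) : X.d0 W h 1 = 0 := by
  simpa using X.d0_mul W h 1 1

namespace Coord

variable {U W : C.even.Opens} (φ : Coord f U) (h : W ≤ U)

/-- The restriction of the even coordinate. -/
abbrev zOn : Γ(C.even, W) := C.resE h φ.z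

/-- The restrictions of the odd coordinates. -/
abbrev θOn (i : Fin 2) : Γ(C.odd, W) := C.resO h (φ.θ i)

/-- The product of the odd coordinates. -/
def vol : Γ(C.even, W) := C.mul W (φ.θOn h 0) (φ.θOn h 1)

lemma dz_zOn : φ.dz.d0 W h (φ.zOn h) = 1 := by
  rw [zOn, φ.dz.d0_res le_rfl h, φ.dz_z, resE_one]

lemma dθ_zOn (i : Fin 2) : (φ.dθ i).d0 W h (φ.zOn h) = 0 := by
  rw [zOn, (φ.dθ i).d0_res le_rfl h, φ.dθ_z, resO_zero]

lemma dθ_θOn (i j : Fin 2) : (φ.dθ i).d1 W h (φ.θOn h j) = if i = j then 1 else 0 := by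
  rw [θOn, (φ.dθ i).d1_res le_rfl h, φ.dθ_θ]
  split_ifs <;> simp

lemma evenField_d0_eq_zero (X : EvenField f W) (hz : X.d0 W le_rfl (φ.zOn h) = 0)
    (hθ : ∀ i, X.d1 W le_rfl (φ.θOn h i) = 0) (a : Γ(C.even, W)) : X.d0 W le_rfl a = 0 := by
  rw [φ.even_d0 W h X W le_rfl a, hz, zero_mul, zero_add]
  exact Finset.sum_eq_zero fun i _ => by rw [hθ i, zero_oddMul]

lemma evenField_d1_eq_zero (X : EvenField f W) (hz : X.d0 W le_rfl (φ.zOn h) = 0)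
    (hθ : ∀ i, X.d1 W le_rfl (φ.θOn h i) = 0) (a : Γ(C.odd, W)) : X.d1 W le_rfl a = 0 := by
  rw [φ.even_d1 W h X W le_rfl a, hz, zero_smul, zero_add]
  exact Finset.sum_eq_zero fun i _ => by rw [hθ i, smul_zero]

/-- The anticommutator of `∂_{θⁱ}` and `∂_{θʲ}` is an even vector field that kills all three
coordinates, and a vector field is determined by its values on the coordinates. -/
lemma dθ_anticomm_even (i j : Fin 2) (a : Γ(C.even, W)) :
    (φ.dθ i).d1 W h ((φ.dθ j).d0 W h a) = - (φ.dθ j).d1 W h ((φ.dθ i).d0 W h a) := by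
  rw [eq_neg_iff_add_eq_zero]
  refine φ.evenField_d0_eq_zero h (((φ.dθ i).bracket (φ.dθ j)).restrict h) ?_ ?_ a
  · simp [dθ_zOn]
  · intro k
    simp only [EvenField.restrict_d1, OddField.bracket_d1, AddMonoidHom.add_apply,
      AddMonoidHom.comp_apply, dθ_θOn]
    split_ifs <;> simp

lemma dθ_anticomm_odd (i j : Fin 2) (x : Γ(C.odd, W)) :
    (φ.dθ i).d0 W h ((φ.dθ j).d1 W h x) = - (φ.dθ j).d0 W h ((φ.dθ i).d1 W h x) := by
  rw [eq_neg_iff_add_eq_zero]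
  refine φ.evenField_d1_eq_zero h (((φ.dθ i).bracket (φ.dθ j)).restrict h) ?_ ?_ x
  · simp [dθ_zOn]
  · intro k
    simp only [EvenField.restrict_d1, OddField.bracket_d1, AddMonoidHom.add_apply,
      AddMonoidHom.comp_apply, dθ_θOn]
    split_ifs <;> simp

end Coord

/-- Twice a section vanishes only if it does, and triple products of odd functions vanish. -/
structure IsOddRankTwo (C : SuperScheme.{u}) : Prop where
  isUnit_two (W : C.even.Opens) : IsUnit (2 : Γ(C.even, W))
  triple (W : C.even.Opens) (x y t : Γ(C.odd, W)) : C.mul W x y • t = 0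

namespace IsOddRankTwo

variable (hC : C.IsOddRankTwo) {W : C.even.Opens}
include hC

lemma even_eq_zero {a : Γ(C.even, W)} (h : a = -a) : a = 0 := by
  have : (2 : Γ(C.even, W)) * a = 0 := by linear_combination h
  exact (hC.isUnit_two W).mul_right_eq_zero.1 this

lemma odd_eq_zero {x : Γ(C.odd, W)} (h : x = -x) : x = 0 := by
  have : (2 : Γ(C.even, W)) • x = 0 := by
    rw [two_smul]; nth_rw 1 [h]; exact neg_add_cancel x
  exact (hC.isUnit_two W).smul_eq_zero.1 this

lemma oddMul_self (x : Γ(C.odd, W)) : C.mul W x x = 0 := hC.even_eq_zero (C.mul_comm W x x)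

lemma oddMul_mul_oddMul (x y s t : Γ(C.odd, W)) : C.mul W x y * C.mul W s t = 0 := by
  rw [← C.smul_mul, hC.triple, zero_oddMul]

end IsOddRankTwo

namespace Coord

variable {U W : C.even.Opens} (φ : Coord f U) (h : W ≤ U)

/-- The even function does not involve the odd coordinates. -/
def IsBody (a : Γ(C.even, W)) : Prop := ∀ i, (φ.dθ i).d0 W h a = 0

/-- The coefficient of `θ¹θ²` in an even function. -/
def top (a : Γ(C.even, W)) : Γ(C.even, W) := (φ.dθ 1).d1 W h ((φ.dθ 0).d0 W h a)

lemma dθ_vol_zero : (φ.dθ 0).d0 W h (φ.vol h) = φ.θOn h 1 := by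
  simp [vol, OddField.d0_mul_odd, dθ_θOn]

lemma dθ_vol_one : (φ.dθ 1).d0 W h (φ.vol h) = -φ.θOn h 0 := by
  simp [vol, OddField.d0_mul_odd, dθ_θOn]

lemma vol_res {W' : C.even.Opens} (h' : W' ≤ W) : C.resE h' (φ.vol h) = φ.vol (h'.trans h) := by
  simp [vol]

variable {φ h}

lemma IsBody.res {W' : C.even.Opens} (h' : W' ≤ W) {a : Γ(C.even, W)} (ha : φ.IsBody h a) :
    φ.IsBody (h'.trans h) (C.resE h' a) := fun i => by
  rw [(φ.dθ i).d0_res h h', ha i, resO_zero]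

lemma IsBody.add {a b : Γ(C.even, W)} (ha : φ.IsBody h a) (hb : φ.IsBody h b) :
    φ.IsBody h (a + b) := fun i => by rw [map_add, ha i, hb i, add_zero]

lemma IsBody.sub {a b : Γ(C.even, W)} (ha : φ.IsBody h a) (hb : φ.IsBody h b) :
    φ.IsBody h (a - b) := fun i => by rw [map_sub, ha i, hb i, sub_zero]

lemma IsBody.mul {a b : Γ(C.even, W)} (ha : φ.IsBody h a) (hb : φ.IsBody h b) :
    φ.IsBody h (a * b) := fun i => by rw [OddField.d0_mul, ha i, hb i, smul_zero, smul_zero, add_zero]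

lemma isBody_one : φ.IsBody h (1 : Γ(C.even, W)) := fun _ => OddField.d0_one _ _ _

lemma isBody_zero : φ.IsBody h (0 : Γ(C.even, W)) := fun _ => map_zero _

lemma isBody_base (V : S.Opens) (hV : W ≤ f ⁻¹ᵁ V) (s : Γ(S, V)) :
    φ.IsBody h (f.appLE V W hV s) := fun i => (φ.dθ i).d0_base W h V hV s

variable (φ h)

lemma isBody_zOn : φ.IsBody h (φ.zOn h) := φ.dθ_zOn h

lemma top_res {W' : C.even.Opens} (h' : W' ≤ W) (a : Γ(C.even, W)) :
    φ.top (h'.trans h) (C.resE h' a) = C.resE h' (φ.top h a) := by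
  rw [top, (φ.dθ 0).d0_res h h', (φ.dθ 1).d1_res h h', top]

lemma top_add (a b : Γ(C.even, W)) : φ.top h (a + b) = φ.top h a + φ.top h b := by
  simp [top]

variable {φ h}

lemma IsBody.top_eq_zero {a : Γ(C.even, W)} (ha : φ.IsBody h a) : φ.top h a = 0 := by
  rw [top, ha 0, map_zero]

lemma IsBody.top_mul_vol {b : Γ(C.even, W)} (hb : φ.IsBody h b) : φ.top h (b * φ.vol h) = b := by
  rw [top, OddField.d0_mul, dθ_vol_zero, hb 0, smul_zero, zero_add, OddField.d1_smul, hb 1,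
    dθ_θOn, zero_oddMul]
  simp

lemma IsBody.mul_vol_injective {b b' : Γ(C.even, W)} (hb : φ.IsBody h b) (hb' : φ.IsBody h b')
    (e : b * φ.vol h = b' * φ.vol h) : b = b' := by
  rw [← hb.top_mul_vol, e, hb'.top_mul_vol]

variable (hC : C.IsOddRankTwo) (φ h)
include hC

lemma dθ_dθ_even (i : Fin 2) (a : Γ(C.even, W)) : (φ.dθ i).d1 W h ((φ.dθ i).d0 W h a) = 0 :=
  hC.even_eq_zero (φ.dθ_anticomm_even h i i a)

lemma dθ_dθ_odd (i : Fin 2) (x : Γ(C.odd, W)) : (φ.dθ i).d0 W h ((φ.dθ i).d1 W h x) = 0 :=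
  hC.odd_eq_zero (φ.dθ_anticomm_odd h i i x)

/-- The triple product `θ¹θ² y` vanishes. Differentiating this relation by `θ¹` and then by `θ²`
leaves `y` itself. -/
lemma odd_eq_zero {y : Γ(C.odd, W)} (hy : ∀ i, (φ.dθ i).d1 W h y = 0) : y = 0 := by
  have h1 : φ.vol h • y = 0 := hC.triple W _ _ y
  have h2 := congrArg ((φ.dθ 0).d1 W h) h1
  rw [OddField.d1_smul, hy 0, mul_zero, add_zero, dθ_vol_zero, map_zero] at h2
  have h3 := congrArg ((φ.dθ 1).d0 W h) h2
  rw [OddField.d0_mul_odd, hy 1, dθ_θOn, zero_smul, sub_zero, map_zero] at h3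
  simpa using h3

lemma isBody_dθ (i : Fin 2) (x : Γ(C.odd, W)) : φ.IsBody h ((φ.dθ i).d1 W h x) := by
  -- The second derivative of an odd function is odd and is killed by both `∂_θ`: by one because its
  -- square is zero, by the other after anticommuting. So `odd_eq_zero` applies.
  have h10 : (φ.dθ 1).d0 W h ((φ.dθ 0).d1 W h x) = 0 := by
    refine φ.odd_eq_zero h hC fun k => ?_
    fin_cases k
    · change (φ.dθ 0).d1 W h _ = 0
      rw [dθ_anticomm_even, dθ_dθ_odd _ _ hC, map_zero, neg_zero]
    · exact φ.dθ_dθ_even h hC 1 _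
  intro k
  fin_cases k <;> fin_cases i
  · exact φ.dθ_dθ_odd h hC 0 x
  · change (φ.dθ 0).d0 W h ((φ.dθ 1).d1 W h x) = 0
    rw [dθ_anticomm_odd, h10, neg_zero]
  · exact h10
  · exact φ.dθ_dθ_odd h hC 1 x

lemma odd_eq (x : Γ(C.odd, W)) : x = (φ.dθ 0).d1 W h x • φ.θOn h 0
    + (φ.dθ 1).d1 W h x • φ.θOn h 1 := by
  rw [← sub_eq_zero]
  refine φ.odd_eq_zero h hC fun i => ?_
  simp only [map_sub, map_add, OddField.d1_smul, φ.isBody_dθ h hC _ _ i, zero_oddMul, dθ_θOn]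
  fin_cases i <;> simp

lemma isBody_top (a : Γ(C.even, W)) : φ.IsBody h (φ.top h a) := φ.isBody_dθ h hC 1 _

/-- This gives the decomposition `a = b + c θ¹θ²` with `b` and `c` free of `θ`. Each odd function
`∂_{θⁱ} a` is expanded by `odd_eq`, where only the mixed second derivative survives. -/
lemma isBody_sub_top (a : Γ(C.even, W)) : φ.IsBody h (a - φ.top h a * φ.vol h) := by
  have hb := φ.isBody_top h hC a
  intro i
  rw [map_sub, OddField.d0_mul, hb i, smul_zero, zero_add, sub_eq_zero,
    φ.odd_eq h hC ((φ.dθ i).d0 W h a)]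
  fin_cases i
  · change (φ.dθ 0).d1 W h ((φ.dθ 0).d0 W h a) • _ + _ = _ • (φ.dθ 0).d0 W h _
    rw [dθ_dθ_even _ _ hC, dθ_vol_zero, zero_smul, zero_add, top]
    rfl
  · change _ + (φ.dθ 1).d1 W h ((φ.dθ 1).d0 W h a) • _ = _ • (φ.dθ 1).d0 W h _
    rw [dθ_dθ_even _ _ hC, dθ_vol_one, zero_smul, add_zero, smul_neg, ← neg_smul, top]
    change (φ.dθ 0).d1 W h ((φ.dθ 1).d0 W h a) • _ = _
    rw [dθ_anticomm_even]

lemma isBody_iff {a : Γ(C.even, W)} : φ.IsBody h a ↔ φ.top h a = 0 := by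
  refine ⟨fun ha => ha.top_eq_zero, fun ha => ?_⟩
  simpa [ha] using φ.isBody_sub_top h hC a

lemma vol_mul_vol : φ.vol h * φ.vol h = 0 := hC.oddMul_mul_oddMul _ _ _ _

/-- The ideal generated by `θ¹θ²`. -/
lemma mul_vol_eq (r : Γ(C.even, W)) :
    φ.top h (r * φ.vol h) * φ.vol h = r * φ.vol h := by
  have h1 := φ.isBody_sub_top h hC r
  have h2 : r * φ.vol h = (r - φ.top h r * φ.vol h) * φ.vol h := by
    rw [sub_mul, _root_.mul_assoc, φ.vol_mul_vol h hC, mul_zero, sub_zero]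
  rw [h2, h1.top_mul_vol]

lemma oddMul_eq (x y : Γ(C.odd, W)) : C.mul W x y
    = ((φ.dθ 0).d1 W h x * (φ.dθ 1).d1 W h y - (φ.dθ 1).d1 W h x * (φ.dθ 0).d1 W h y)
      * φ.vol h := by
  conv_lhs => rw [φ.odd_eq h hC x, φ.odd_eq h hC y]
  simp only [oddAdd_mul, oddMul_add, smul_oddMul, oddMul_smul, hC.oddMul_self, vol]
  rw [C.mul_comm W (φ.θOn h 1) (φ.θOn h 0)]
  ring

end Coord

end SuperScheme

/-! ### Odd rank two and the even closed subscheme -/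

namespace SuperScheme

variable {C : SuperScheme.{u}} {S : Scheme.{u}} {f : C.even ⟶ S}

section Local

variable {W : C.even.Opens}

lemma even_ext {a b : Γ(C.even, W)}
    (h : ∀ w ∈ W, ∃ (V : C.even.Opens) (hV : V ≤ W), w ∈ V ∧ C.resE hV a = C.resE hV b) :
    a = b := by
  choose V hV hw e using h
  refine C.even.sheaf.eq_of_locally_eq' (fun w : W => V w.1 w.2) W
    (fun w => homOfLE (hV w.1 w.2)) (fun w hw' => ?_) a b fun w => e w.1 w.2
  exact Opens.mem_iSup.2 ⟨⟨w, hw'⟩, hw w hw'⟩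

lemma odd_ext {a b : Γ(C.odd, W)}
    (h : ∀ w ∈ W, ∃ (V : C.even.Opens) (hV : V ≤ W), w ∈ V ∧ C.resO hV a = C.resO hV b) :
    a = b := by
  choose V hV hw e using h
  refine TopCat.Sheaf.eq_of_locally_eq' ⟨_, C.odd.isSheaf⟩ (fun w : W => V w.1 w.2) W
    (fun w => homOfLE (hV w.1 w.2)) (fun w hw' => ?_) a b fun w => e w.1 w.2
  exact Opens.mem_iSup.2 ⟨⟨w, hw'⟩, hw w hw'⟩

lemma exists_even_glue {ι : Type u} (V : ι → C.even.Opens) (hV : ∀ i, V i ≤ W)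
    (cover : ∀ w ∈ W, ∃ i, w ∈ V i) (a : ∀ i, Γ(C.even, V i))
    (compat : ∀ i j, C.resE (inf_le_left : V i ⊓ V j ≤ V i) (a i)
      = C.resE (inf_le_right : V i ⊓ V j ≤ V j) (a j)) :
    ∃ b : Γ(C.even, W), ∀ i, C.resE (hV i) b = a i :=
  (C.even.sheaf.existsUnique_gluing' V W (fun i => homOfLE (hV i))
    (fun w hw => Opens.mem_iSup.2 (cover w hw)) a compat).exists

lemma isUnit_resE_basicOpen (g : Γ(C.even, W)) :
    IsUnit (C.resE (C.even.basicOpen_le g) g) :=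
  RingedSpace.isUnit_res_basicOpen _ g

lemma exists_odd_lift (hW : IsAffineOpen W) (g : Γ(C.even, W))
    (x : Γ(C.odd, C.even.basicOpen g)) :
    ∃ (c : Γ(C.even, C.even.basicOpen g)) (y : Γ(C.odd, W)), IsUnit c ∧
      C.resO (C.even.basicOpen_le g) y = c • x := by
  have := C.quasicoherent
  obtain ⟨n, y, hy⟩ := C.odd.exists_res_eq_pow_smul hW g x
  exact ⟨_, y, (isUnit_resE_basicOpen g).pow n, hy⟩

end Local

lemma isUnit_two_of_charZero {k : Type u} [Field k] [CharZero k]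
    (s : S ⟶ Spec (CommRingCat.of k)) (f : C.even ⟶ S) (W : C.even.Opens) :
    IsUnit (2 : Γ(C.even, W)) := by
  let r : k →+* Γ(C.even, W) := ((Scheme.ΓSpecIso (CommRingCat.of k)).inv ≫ (f ≫ s).appTop ≫
    C.even.presheaf.map (homOfLE le_top).op).hom
  have h2 : IsUnit (2 : k) := two_ne_zero.isUnit
  rw [← map_ofNat r 2]
  exact h2.map r

/-- Where odd functions are combinations of `θ¹, θ²`, it suffices that `θ¹θ²θⁱ = 0`, which follows
from anticommutativity once `2` is invertible. Quasi-coherence passes from the open sets of the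
local model to arbitrary ones. -/
lemma IsSmoothCurve12.isOddRankTwo (hf : IsSmoothCurve12 f)
    (h2 : ∀ W : C.even.Opens, IsUnit (2 : Γ(C.even, W))) : C.IsOddRankTwo := by
  refine ⟨h2, fun W x y t => odd_ext fun w hw => ?_⟩
  obtain ⟨U, V, h, hwU, hU, -, A, φ, σ, θ, -, -, -, hb⟩ := hf w
  have key : ∀ x y t : Γ(C.odd, U), C.mul U x y • t = 0 := by
    have hz {y : Γ(C.odd, U)} (h : y = -y) : y = 0 := by
      have : (2 : Γ(C.even, U)) • y = 0 := by
        rw [two_smul]; nth_rw 1 [h]; exact neg_add_cancel y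
      exact (h2 U).smul_eq_zero.1 this
    have hsq (x : Γ(C.odd, U)) : C.mul U x x = 0 := by
      have h3 := C.mul_comm U x x
      have : (2 : Γ(C.even, U)) * C.mul U x x = 0 := by linear_combination h3
      exact (h2 U).mul_right_eq_zero.1 this
    have e1 : C.mul U (θ 0) (θ 1) • θ 1 = 0 := by
      rw [C.mul_assoc, hsq, zero_smul]
    have e0 : C.mul U (θ 0) (θ 1) • θ 0 = 0 := hz <| by
      nth_rw 1 [C.mul_assoc]
      rw [C.mul_comm, neg_smul]
    intro x y t
    obtain ⟨⟨x0, x1⟩, rfl⟩ := hb.2 x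
    obtain ⟨⟨y0, y1⟩, rfl⟩ := hb.2 y
    obtain ⟨⟨t0, t1⟩, rfl⟩ := hb.2 t
    have e : C.mul U (σ x0 • θ 0 + σ x1 • θ 1) (σ y0 • θ 0 + σ y1 • θ 1)
        = (σ x0 * σ y1 - σ x1 * σ y0) * C.mul U (θ 0) (θ 1) := by
      simp only [oddAdd_mul, oddMul_add, smul_oddMul, oddMul_smul, hsq]
      rw [C.mul_comm U (θ 1) (θ 0)]
      ring
    dsimp only
    rw [e, mul_smul, smul_add, smul_comm _ (σ t0), smul_comm _ (σ t1), e0, e1]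
    simp only [smul_zero, add_zero]
  -- The local model describes sections over `U` only. On a basic open set of `U` inside `W`, unit
  -- multiples of the given sections extend to `U`, where `key` applies.
  obtain ⟨g, hg, hwg⟩ := hU.exists_basicOpen_le (V := W) ⟨w, hw⟩ hwU
  refine ⟨C.even.basicOpen g, hg, hwg, ?_⟩
  obtain ⟨a, x', ha, hx⟩ := exists_odd_lift hU g (C.resO hg x)
  obtain ⟨b, y', hb, hy⟩ := exists_odd_lift hU g (C.resO hg y)
  obtain ⟨c, t', hc, ht⟩ := exists_odd_lift hU g (C.resO hg t)
  have := congrArg (C.resO (C.even.basicOpen_le g)) (key x' y' t')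
  rw [resO_smul, resE_oddMul, hx, hy, ht, smul_oddMul, oddMul_smul, resO_zero, ← _root_.mul_assoc,
    smul_smul, mul_right_comm, mul_smul] at this
  rw [resO_smul, resE_oddMul, resO_zero]
  exact ((ha.mul hb).mul hc).smul_eq_zero.1 this

/-- Up to units, odd sections over a basic open set extend, so their products generate nothing new.
This compatibility is what makes the products of odd functions define an ideal sheaf. -/
lemma map_span_oddMul {W : C.even.Opens} (hW : IsAffineOpen W) (g : Γ(C.even, W)) :
    (Ideal.span (Set.range fun p : Γ(C.odd, W) × Γ(C.odd, W) => C.mul W p.1 p.2)).map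
        (C.even.presheaf.map (homOfLE (C.even.basicOpen_le g)).op).hom
      = Ideal.span (Set.range fun p : Γ(C.odd, C.even.basicOpen g) × Γ(C.odd, C.even.basicOpen g) =>
          C.mul (C.even.basicOpen g) p.1 p.2) := by
  rw [Ideal.map_span]
  apply le_antisymm
  · rw [Ideal.span_le]
    rintro _ ⟨_, ⟨⟨x, y⟩, rfl⟩, rfl⟩
    exact Ideal.subset_span ⟨(C.resO (C.even.basicOpen_le g) x,
      C.resO (C.even.basicOpen_le g) y), (resE_oddMul _ x y).symm⟩
  · rw [Ideal.span_le]
    rintro _ ⟨⟨x, y⟩, rfl⟩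
    obtain ⟨a, x', ha, hx⟩ := exists_odd_lift hW g x
    obtain ⟨b, y', hb, hy⟩ := exists_odd_lift hW g y
    have : C.resE (C.even.basicOpen_le g) (C.mul W x' y')
        = a * b * C.mul (C.even.basicOpen g) x y := by
      rw [resE_oddMul, hx, hy, smul_oddMul, oddMul_smul, _root_.mul_assoc]
    rw [SetLike.mem_coe, ← Ideal.unit_mul_mem_iff_mem _ (ha.mul hb), ← this]
    exact Ideal.subset_span ⟨_, ⟨(x', y'), rfl⟩, rfl⟩

/-- The ideal sheaf generated by the products of odd functions. -/
def oddIdeal (C : SuperScheme.{u}) : C.even.IdealSheafData where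
  ideal W := Ideal.span (Set.range fun p : Γ(C.odd, W) × Γ(C.odd, W) => C.mul W p.1 p.2)
  map_ideal_basicOpen W g := map_span_oddMul W.2 g

/-- The even closed subscheme of a superscheme, defined by the vanishing of all odd functions. -/
def bosonic (C : SuperScheme.{u}) : Scheme.{u} := C.oddIdeal.subscheme

/-- The inclusion of the even closed subscheme. -/
def bosonicι (C : SuperScheme.{u}) : C.bosonic ⟶ C.even := C.oddIdeal.subschemeι

instance : IsClosedImmersion C.bosonicι := by
  unfold bosonicι bosonic; infer_instance

lemma bosonicι_app_surjective {W : C.even.Opens} (hW : IsAffineOpen W) :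
    Function.Surjective (C.bosonicι.app W) :=
  C.oddIdeal.subschemeι_app_surjective ⟨W, hW⟩

lemma bosonicι_app_eq_zero_iff {W : C.even.Opens} (hW : IsAffineOpen W) {a : Γ(C.even, W)} :
    C.bosonicι.app W a = 0 ↔
      a ∈ Ideal.span (Set.range fun p : Γ(C.odd, W) × Γ(C.odd, W) => C.mul W p.1 p.2) :=
  (SetLike.ext_iff.1 (C.oddIdeal.ker_subschemeι_app ⟨W, hW⟩) a)

/-- Restriction of functions on the even closed subscheme. -/
lemma bosonicι_app_res {W U : C.even.Opens} (h : W ≤ U) (a : Γ(C.even, U)) :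
    C.bosonicι.app W (C.resE h a) = C.bosonic.presheaf.map
      (homOfLE (show C.bosonicι ⁻¹ᵁ W ≤ C.bosonicι ⁻¹ᵁ U from fun _ hx => h hx)).op
      (C.bosonicι.app U a) :=
  congr($(C.bosonicι.naturality (homOfLE h).op) a)

lemma isPoint_bosonicι (C : SuperScheme.{u}) : IsPoint C.bosonicι := by
  intro W x y
  refine C.bosonic.sheaf.eq_of_locally_eq'
    (fun V : {V : C.even.affineOpens // V.1 ≤ W} => C.bosonicι ⁻¹ᵁ V.1.1) _
    (fun V => homOfLE fun _ hx => V.2 hx) (fun w hw => ?_) _ _ fun V => ?_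
  · obtain ⟨V, hV, hwV, hVW⟩ := Opens.isBasis_iff_nbhd.1 C.even.isBasis_affineOpens
      (show C.bosonicι w ∈ W from hw)
    exact Opens.mem_iSup.2 ⟨⟨⟨V, hV⟩, hVW⟩, hwV⟩
  · refine ((bosonicι_app_res V.2 (C.mul W x y)).symm.trans ?_).trans (map_zero _).symm
    rw [bosonicι_app_eq_zero_iff V.1.2, resE_oddMul]
    exact Ideal.subset_span ⟨(_, _), rfl⟩

/-- Products of odd functions square to zero, so the closed subscheme that they define is supported
everywhere. -/
lemma isHomeomorph_bosonicι (hC : C.IsOddRankTwo) : IsHomeomorph C.bosonicι := by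
  rw [isHomeomorph_iff_isEmbedding_surjective]
  refine ⟨C.bosonicι.isEmbedding, ?_⟩
  rw [← Set.range_eq_univ]
  refine (C.oddIdeal.range_subschemeι).trans (Set.eq_univ_of_forall fun x => ?_)
  change x ∈ C.oddIdeal.supportSet
  rw [Scheme.IdealSheafData.mem_supportSet_iff]
  intro U
  rw [oddIdeal, Scheme.zeroLocus_span, Scheme.mem_zeroLocus_iff]
  rintro _ ⟨⟨y, t⟩, rfl⟩ hx
  have : C.even.basicOpen (C.mul U y t * C.mul U y t) = C.even.basicOpen (C.mul U y t) := by
    rw [Scheme.basicOpen_mul, inf_idem]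
  rw [hC.oddMul_mul_oddMul, Scheme.basicOpen_zero] at this
  rw [← this] at hx
  exact hx

end SuperScheme

/-! ### Changes of coordinates -/

namespace SuperScheme

variable {C : SuperScheme.{u}} {S : Scheme.{u}} {f : C.even ⟶ S}

lemma exists_affine_le {X : Scheme.{u}} {W : X.Opens} {w : X} (hw : w ∈ W) :
    ∃ V : X.Opens, IsAffineOpen V ∧ V ≤ W ∧ w ∈ V := by
  obtain ⟨V, hV, hwV, hVW⟩ := Opens.isBasis_iff_nbhd.1 X.isBasis_affineOpens hw
  exact ⟨V, hV, hVW, hwV⟩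

lemma ι_comp_appLE_eq_zero {X Y : Scheme.{u}} (i : X ⟶ Y) {V W : Y.Opens} (h : V ≤ W)
    (hp : (⊤ : (i ⁻¹ᵁ V).toScheme.Opens) ≤ ((i ⁻¹ᵁ V).ι ≫ i) ⁻¹ᵁ W) {t : Γ(Y, W)}
    (h0 : ((i ⁻¹ᵁ V).ι ≫ i).appLE W ⊤ hp t = 0) :
    i.app V (Y.presheaf.map (homOfLE h).op t) = 0 := by
  have hp' : (⊤ : (i ⁻¹ᵁ V).toScheme.Opens) ≤ (i ⁻¹ᵁ V).ι ⁻¹ᵁ (i ⁻¹ᵁ W) := hp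
  have h1 : (i.app W ≫ (i ⁻¹ᵁ V).ι.appLE (i ⁻¹ᵁ W) ⊤ hp') t = 0 := by
    rwa [Scheme.Hom.comp_appLE] at h0
  rw [Scheme.Opens.ι_appLE] at h1
  have h2 := congrArg (X.presheaf.map (eqToHom (Scheme.Opens.ι_image_top _).symm).op) h1
  refine Eq.trans ?_ (h2.trans (map_zero _))
  rw [← CommRingCat.comp_apply, Scheme.Hom.naturality]
  exact (X.presheaf_map_map _ _ _ _).symm

namespace Coord

section

variable {U W : C.even.Opens} (φ : Coord f U) (h : W ≤ U) (hC : C.IsOddRankTwo)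
include hC

/-- On affine open sets the kernel is generated by products of odd functions, each a multiple of
`θ¹θ²`; such multiples may be taken with coefficient free of `θ` because `(θ¹θ²)² = 0`. The
condition on the right is an equation between sections, hence local. -/
lemma bosonicι_app_eq_zero_iff {a : Γ(C.even, W)} :
    C.bosonicι.app W a = 0 ↔ a = φ.top h a * φ.vol h := by
  constructor
  · intro ha
    refine even_ext fun w hw => ?_
    obtain ⟨V, hV, hVW, hwV⟩ := exists_affine_le hw
    refine ⟨V, hVW, hwV, ?_⟩
    rw [resE_mul, vol_res, ← top_res]
    have h0 : C.bosonicι.app V (C.resE hVW a) = 0 := by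
      rw [bosonicι_app_res, ha]; exact map_zero _
    rw [SuperScheme.bosonicι_app_eq_zero_iff hV] at h0
    generalize C.resE hVW a = b at h0 ⊢
    induction h0 using Submodule.span_induction with
    | mem b hb =>
      obtain ⟨⟨x, y⟩, rfl⟩ := hb
      dsimp only
      rw [φ.oddMul_eq (hVW.trans h) hC x y, mul_vol_eq _ _ hC]
    | zero => simp [top]
    | add b b' _ _ hb hb' =>
      rw [top_add, add_mul, ← hb, ← hb']
    | smul r b _ hb =>
      have : r • b = (r * φ.top (hVW.trans h) b) * φ.vol (hVW.trans h) := by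
        rw [_root_.mul_assoc, ← hb, smul_eq_mul]
      rw [this, mul_vol_eq _ _ hC]
  · intro ha
    rw [ha, map_mul, show C.bosonicι.app W (φ.vol h) = 0 from C.isPoint_bosonicι W _ _, mul_zero]

variable {φ h}

lemma IsBody.eq_zero {a : Γ(C.even, W)} (ha : φ.IsBody h a) (h0 : C.bosonicι.app W a = 0) :
    a = 0 := by
  rw [φ.bosonicι_app_eq_zero_iff h hC, ha.top_eq_zero, zero_mul] at h0
  exact h0

end

/-- The even coordinate of `ψ` does not involve the odd coordinates of `φ` if the change of
coordinates is in `Aut^Δ`. -/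
lemma isBody_of_changeInAutDelta {U U' : C.even.Opens} {φ : Coord f U} {ψ : Coord f U'}
    (hC : C.IsOddRankTwo) (hφ : ChangeInAutDelta φ ψ) :
    φ.IsBody (inf_le_left : U ⊓ U' ≤ U) (ψ.zOn inf_le_right) := by
  rw [φ.isBody_iff _ hC]
  refine even_ext fun w hw => ?_
  obtain ⟨V, hV, hVU, hwV⟩ := exists_affine_le hw
  refine ⟨V, hVU, hwV, ?_⟩
  rw [resE_zero]
  set t := φ.top (inf_le_left : U ⊓ U' ≤ U) (ψ.zOn inf_le_right) with ht
  have htb : φ.IsBody (hVU.trans inf_le_left) (C.resE hVU t) := (φ.isBody_top _ hC _).res hVU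
  refine htb.eq_zero hC ?_
  -- The inclusion of an affine piece of `C₀` is itself a point of `C`; this one point per piece
  -- suffices.
  let T : C.bosonic.Opens := C.bosonicι ⁻¹ᵁ V
  have hT : IsAffine T := hV.preimage C.bosonicι
  let p : T.toScheme ⟶ C.even := T.ι ≫ C.bosonicι
  have hp : (⊤ : T.toScheme.Opens) ≤ p ⁻¹ᵁ (U ⊓ U') := fun x _ => hVU x.2
  have hpt : IsPoint p := fun W x y => by
    simp only [p, Scheme.Hom.comp_app]
    change T.ι.app _ (C.bosonicι.app W _) = 0
    rw [C.isPoint_bosonicι]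
    exact map_zero _
  -- The constant term of the `θ¹θ²`-component of the Taylor expansion is the restriction of `t` to
  -- `C₀`.
  have key := congrArg (PowerSeries.coeff 0) (hφ T p hpt hp).isBody.2.2
  have key' : PowerSeries.coeff 0 ((PowerSeries.mk fun n =>
      Ring.inverse (n.factorial : Γ(T, ⊤)) * p.appLE (U ⊓ U') ⊤ hp
        ((φ.dz.d0 (U ⊓ U') inf_le_left)^[n] t)) - 0) = 0 := key
  have h0 : p.appLE (U ⊓ U') ⊤ hp t = 0 := by simpa using key'
  exact ι_comp_appLE_eq_zero C.bosonicι hVU hp h0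

variable {U U' W : C.even.Opens} {φ : Coord f U} {ψ : Coord f U'} {h : W ≤ U} {h' : W ≤ U'}

/-- By the chain rule, `∂_{θ}` in the chart `ψ` is a combination of the derivatives in `φ`; its
`∂_z`-term carries the factor `∂_θ z`, which is zero by `hz`. -/
lemma IsBody.of_coord (hz : ψ.IsBody h' (φ.zOn h)) {a : Γ(C.even, W)} (ha : φ.IsBody h a) :
    ψ.IsBody h' a := fun k => by
  have := φ.odd_d0 W h ((ψ.dθ k).restrict h') W le_rfl a
  simp only [OddField.restrict_d0] at this
  rw [this, show (ψ.dθ k).d0 W _ (C.resE _ φ.z) = 0 from hz k, smul_zero, zero_add]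
  exact Finset.sum_eq_zero fun i _ => by rw [ha i, smul_zero]

/-- On functions of the even coordinate, the section `∂_z b · θ¹θ²` does not depend on the
coordinates. -/
lemma dz_mul_vol_eq (hC : C.IsOddRankTwo) (hz : φ.IsBody h (ψ.zOn h'))
    (hJ : berJacobian φ ψ W h h' = 1) {b : Γ(C.even, W)} (hb : ψ.IsBody h' b) :
    φ.dz.d0 W h b * φ.vol h = ψ.dz.d0 W h' b * ψ.vol h' := by
  set D : Matrix (Fin 2) (Fin 2) Γ(C.even, W) :=
    Matrix.of fun i j => (φ.dθ i).d1 W h (ψ.θOn h' j) with hD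
  have h1 : φ.dz.d0 W h (ψ.zOn h') * Ring.inverse D.det = 1 := by
    have h2 : berJacobian φ ψ W h h' = (φ.dz.d0 W h (ψ.zOn h')
      - ∑ j, ∑ k, D⁻¹ j k * C.mul W (φ.dz.d1 W h (ψ.θOn h' j)) ((φ.dθ k).d0 W h (ψ.zOn h')))
        * Ring.inverse D.det := rfl
    -- The block `C = (∂_θ w)` of the Jacobian is zero, so the correction term of the Berezinian
    -- drops out.
    simp only [hz _, oddMul_zero, mul_zero, Finset.sum_const_zero, sub_zero] at h2
    rw [← h2, hJ]
  have hdet : φ.dz.d0 W h (ψ.zOn h') = D.det := by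
    -- If `det D` were not a unit, `Ring.inverse` would be `0`, so `1 = 0` and the ring is trivial;
    -- no invertibility has to be known beforehand.
    by_cases hu : IsUnit D.det
    · have h3 := congrArg (· * D.det) h1
      simpa [_root_.mul_assoc, Ring.inverse_mul_cancel _ hu] using h3
    · rw [Ring.inverse_non_unit _ hu, mul_zero] at h1
      exact eq_of_zero_eq_one h1 _ _
  have hvol : ψ.vol h' = D.det * φ.vol h := by
    rw [vol, φ.oddMul_eq h hC, Matrix.det_fin_two]
    simp only [hD, Matrix.of_apply]
    ring
  have hdz : φ.dz.d0 W h b = φ.dz.d0 W h (ψ.zOn h') * ψ.dz.d0 W h' b := by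
    have := ψ.even_d0 W h' (φ.dz.restrict h) W le_rfl b
    simp only [EvenField.restrict_d0] at this
    rw [this, Finset.sum_eq_zero fun i _ => by rw [hb i, oddMul_zero], add_zero]
  rw [hvol, hdz, hdet]
  ring

end Coord

/-! ### Split atlases and the lifting of functions from the even part -/

/-- An atlas of coordinates whose even coordinates generate the same functions and whose
volume forms agree. -/
structure SplitAtlas (f : C.even ⟶ S) where
  rank : C.IsOddRankTwo
  ι : Type u
  U : ι → C.even.Opens
  φ : ∀ i, Coord f (U i)
  cover : ∀ x, ∃ i, x ∈ U i
  z_body : ∀ i j (W : C.even.Opens) (h : W ≤ U i) (h' : W ≤ U j),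
    (φ i).IsBody h ((φ j).zOn h')
  dz_vol : ∀ i j (W : C.even.Opens) (h : W ≤ U i) (h' : W ≤ U j) (b : Γ(C.even, W)),
    (φ i).IsBody h b → (φ i).dz.d0 W h b * (φ i).vol h = (φ j).dz.d0 W h' b * (φ j).vol h'

/-- Here alone the section `Δ` and the condition `Aut^Δ` are consumed; the splitting is then
constructed from the atlas alone. -/
lemma IsS2Curve.nonempty_splitAtlas {k : Type u} [Field k] [CharZero k]
    (s : S ⟶ Spec (CommRingCat.of k)) {Δ : BerSection f} (hC : IsS2Curve f Δ) :
    Nonempty (SplitAtlas f) := by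
  obtain ⟨hsm, ι, U, φ, hU, hΔ, hA⟩ := hC
  have rank := hsm.isOddRankTwo (isUnit_two_of_charZero s f)
  have z_body (i j) (W : C.even.Opens) (h : W ≤ U i) (h' : W ≤ U j) :
      (φ i).IsBody h ((φ j).zOn h') := by
    have := (Coord.isBody_of_changeInAutDelta rank (hA i j)).res (le_inf h h')
    rwa [Coord.zOn, resE_resE] at this
  refine ⟨⟨rank, ι, U, φ, fun x => Opens.mem_iSup.1 (hU ▸ Opens.mem_top x), z_body,
    fun i j W h h' b hb => ?_⟩⟩
  refine Coord.dz_mul_vol_eq rank (z_body _ _ _ _ _) ?_ (.of_coord (z_body j i W h' h) hb)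
  have := Δ.coeff_eq _ _ (φ i) (φ j) W h h'
  rwa [show Δ.coeff _ (φ i) = 1 from hΔ i, show Δ.coeff _ (φ j) = 1 from hΔ j, resE_one, resE_one,
    one_mul, eq_comm] at this

namespace SplitAtlas

variable (𝒜 : SplitAtlas f) {W : C.even.Opens}

lemma isBody_coord {i j : 𝒜.ι} {h : W ≤ 𝒜.U i} {h' : W ≤ 𝒜.U j} {a : Γ(C.even, W)}
    (ha : (𝒜.φ i).IsBody h a) : (𝒜.φ j).IsBody h' a :=
  .of_coord (𝒜.z_body j i W h' h) ha

/-- The even functions that locally do not involve the odd coordinates. -/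
def IsBody (a : Γ(C.even, W)) : Prop :=
  ∀ i (V : C.even.Opens) (hV : V ≤ W) (h : V ≤ 𝒜.U i), (𝒜.φ i).IsBody h (C.resE hV a)

variable {𝒜}

lemma isBody_iff {i : 𝒜.ι} (h : W ≤ 𝒜.U i) {a : Γ(C.even, W)} :
    𝒜.IsBody a ↔ (𝒜.φ i).IsBody h a := by
  refine ⟨fun ha => by simpa using ha i W le_rfl h, fun ha j V hV hj => ?_⟩
  exact 𝒜.isBody_coord (ha.res hV)

lemma IsBody.res {V : C.even.Opens} (hV : V ≤ W) {a : Γ(C.even, W)} (ha : 𝒜.IsBody a) :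
    𝒜.IsBody (C.resE hV a) := fun i V' hV' h => by
  rw [resE_resE]; exact ha i V' _ h

lemma IsBody.add {a b : Γ(C.even, W)} (ha : 𝒜.IsBody a) (hb : 𝒜.IsBody b) :
    𝒜.IsBody (a + b) := fun i V hV h => by
  rw [resE_add]; exact (ha i V hV h).add (hb i V hV h)

lemma IsBody.sub {a b : Γ(C.even, W)} (ha : 𝒜.IsBody a) (hb : 𝒜.IsBody b) :
    𝒜.IsBody (a - b) := fun i V hV h => by
  rw [resE_sub]; exact (ha i V hV h).sub (hb i V hV h)

lemma IsBody.mul {a b : Γ(C.even, W)} (ha : 𝒜.IsBody a) (hb : 𝒜.IsBody b) :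
    𝒜.IsBody (a * b) := fun i V hV h => by
  rw [resE_mul]; exact (ha i V hV h).mul (hb i V hV h)

lemma isBody_one : 𝒜.IsBody (1 : Γ(C.even, W)) := fun i V hV h => by
  rw [resE_one]; exact Coord.isBody_one

lemma isBody_base (V : S.Opens) (hV : W ≤ f ⁻¹ᵁ V) (s : Γ(S, V)) :
    𝒜.IsBody (f.appLE V W hV s) := fun i V' hV' h => by
  have : C.resE hV' (f.appLE V W hV s) = f.appLE V V' (hV'.trans hV) s := by
    rw [resE, ← CommRingCat.comp_apply, Scheme.Hom.appLE_map]
  rw [this]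
  exact Coord.isBody_base V _ s

variable (𝒜) in
lemma exists_chart {w : C.even} (hw : w ∈ W) :
    ∃ (V : C.even.Opens) (_ : V ≤ W) (i : 𝒜.ι), V ≤ 𝒜.U i ∧ IsAffineOpen V ∧ w ∈ V := by
  obtain ⟨i, hi⟩ := 𝒜.cover w
  obtain ⟨V, hV, hVW, hwV⟩ := exists_affine_le (show w ∈ W ⊓ 𝒜.U i from ⟨hw, hi⟩)
  exact ⟨V, hVW.trans inf_le_left, i, hVW.trans inf_le_right, hV, hwV⟩

lemma isBody_of_locally {a : Γ(C.even, W)} (H : ∀ w ∈ W, ∃ (V : C.even.Opens) (hV : V ≤ W),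
    w ∈ V ∧ 𝒜.IsBody (C.resE hV a)) : 𝒜.IsBody a := by
  intro i V hV h k
  refine odd_ext fun w hw => ?_
  obtain ⟨V', hV', hwV, hb⟩ := H w (hV hw)
  refine ⟨V ⊓ V', inf_le_left, ⟨hw, hwV⟩, ?_⟩
  rw [← OddField.d0_res, resE_resE, resO_zero]
  have := hb i (V ⊓ V') inf_le_right (inf_le_left.trans h) k
  rwa [resE_resE] at this

lemma IsBody.eq_zero {a : Γ(C.even, W)} (ha : 𝒜.IsBody a) (h0 : C.bosonicι.app W a = 0) :
    a = 0 := by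
  refine even_ext fun w hw => ?_
  obtain ⟨V, hV, i, hi, -, hwV⟩ := 𝒜.exists_chart hw
  refine ⟨V, hV, hwV, ?_⟩
  rw [resE_zero]
  refine (ha i V hV hi).eq_zero 𝒜.rank ?_
  rw [bosonicι_app_res, h0]
  exact map_zero _

lemma IsBody.ext {a b : Γ(C.even, W)} (ha : 𝒜.IsBody a) (hb : 𝒜.IsBody b)
    (h : C.bosonicι.app W a = C.bosonicι.app W b) : a = b := by
  rw [← sub_eq_zero]
  refine (ha.sub hb).eq_zero ?_
  rw [map_sub, h, sub_self]

-- On affine pieces of charts a function on `C₀` extends, and removing the `θ¹θ²`-term of the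
-- extension changes nothing on `C₀`. The results glue because a function free of `θ` is determined
-- by its restriction to `C₀`.
variable (𝒜) in
lemma exists_isBody_app_eq (r : Γ(C.bosonic, C.bosonicι ⁻¹ᵁ W)) :
    ∃ a : Γ(C.even, W), 𝒜.IsBody a ∧ C.bosonicι.app W a = r := by
  have hloc (V : {V : C.even.Opens // V ≤ W ∧ IsAffineOpen V ∧ ∃ i, V ≤ 𝒜.U i}) :
      ∃ a : Γ(C.even, V.1), 𝒜.IsBody a ∧ C.bosonicι.app V.1 a = C.bosonic.presheaf.map
        (homOfLE (show C.bosonicι ⁻¹ᵁ V.1 ≤ C.bosonicι ⁻¹ᵁ W from fun _ hx => V.2.1 hx)).op r := by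
    obtain ⟨V, hV, hVa, i, hi⟩ := V
    obtain ⟨a, ha⟩ := bosonicι_app_surjective hVa (C.bosonic.presheaf.map
        (homOfLE (show C.bosonicι ⁻¹ᵁ V ≤ C.bosonicι ⁻¹ᵁ W from fun _ hx => hV hx)).op r)
    refine ⟨a - (𝒜.φ i).top hi a * (𝒜.φ i).vol hi,
      (isBody_iff hi).2 ((𝒜.φ i).isBody_sub_top hi 𝒜.rank a), ?_⟩
    rw [map_sub, ha, map_mul, show C.bosonicι.app V ((𝒜.φ i).vol hi) = 0 from
      C.isPoint_bosonicι V _ _, mul_zero, sub_zero]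
  choose a ha ha' using hloc
  have hcov : ∀ w ∈ W, ∃ V : {V : C.even.Opens // V ≤ W ∧ IsAffineOpen V ∧ ∃ i, V ≤ 𝒜.U i},
      w ∈ V.1 := fun w hw => by
    obtain ⟨V, hV, i, hi, hVa, hwV⟩ := 𝒜.exists_chart hw
    exact ⟨⟨V, hV, hVa, i, hi⟩, hwV⟩
  obtain ⟨b, hb⟩ := exists_even_glue (fun V : {V : C.even.Opens // V ≤ W ∧ IsAffineOpen V ∧
    ∃ i, V ≤ 𝒜.U i} => V.1) (fun V => V.2.1) hcov a fun V V' => by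
      refine ((ha V).res _).ext ((ha V').res _) ?_
      rw [bosonicι_app_res, bosonicι_app_res, ha', ha']
      simp only [← CommRingCat.comp_apply, ← Functor.map_comp]
      rfl
  refine ⟨b, isBody_of_locally fun w hw => ?_, ?_⟩
  · obtain ⟨V, hwV⟩ := hcov w hw
    exact ⟨V.1, V.2.1, hwV, hb V ▸ ha V⟩
  · refine C.bosonic.sheaf.eq_of_locally_eq'
      (fun V : {V : C.even.Opens // V ≤ W ∧ IsAffineOpen V ∧ ∃ i, V ≤ 𝒜.U i} =>
        C.bosonicι ⁻¹ᵁ V.1) _ (fun V => homOfLE fun _ hx => V.2.1 hx) (fun w hw => ?_) _ _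
        fun V => ?_
    · obtain ⟨V, hwV⟩ := hcov _ hw
      exact Opens.mem_iSup.2 ⟨V, hwV⟩
    · refine (bosonicι_app_res V.2.1 b).symm.trans ?_
      rw [hb, ha']
      rfl

variable (𝒜 W) in
/-- The function that does not involve the odd coordinates and has a given restriction to the
even closed subscheme. -/
def liftFun (r : Γ(C.bosonic, C.bosonicι ⁻¹ᵁ W)) : Γ(C.even, W) :=
  (𝒜.exists_isBody_app_eq r).choose

lemma isBody_liftFun (r : Γ(C.bosonic, C.bosonicι ⁻¹ᵁ W)) : 𝒜.IsBody (𝒜.liftFun W r) :=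
  (𝒜.exists_isBody_app_eq r).choose_spec.1

lemma app_liftFun (r : Γ(C.bosonic, C.bosonicι ⁻¹ᵁ W)) :
    C.bosonicι.app W (𝒜.liftFun W r) = r :=
  (𝒜.exists_isBody_app_eq r).choose_spec.2

variable (𝒜 W) in
/-- `liftFun` as a multiplicative map. -/
def liftMonoidHom : Γ(C.bosonic, C.bosonicι ⁻¹ᵁ W) →* Γ(C.even, W) where
  toFun := 𝒜.liftFun W
  map_one' := (isBody_liftFun _).ext isBody_one ((app_liftFun _).trans (map_one _).symm)
  map_mul' r r' := (isBody_liftFun _).ext ((isBody_liftFun r).mul (isBody_liftFun r')) <|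
    (app_liftFun _).trans <| .trans (congrArg₂ (· * ·) (app_liftFun r).symm (app_liftFun r').symm)
      (map_mul _ _ _).symm

variable (𝒜 W) in
/-- The section of the restriction of functions to the even closed subscheme whose image consists
of the functions that do not involve the odd coordinates. -/
def lift : Γ(C.bosonic, C.bosonicι ⁻¹ᵁ W) ⟶ Γ(C.even, W) :=
  CommRingCat.ofHom <| .mk' (𝒜.liftMonoidHom W) fun r r' =>
    (isBody_liftFun _).ext ((isBody_liftFun r).add (isBody_liftFun r')) <|
      (app_liftFun _).trans <| .trans (congrArg₂ (· + ·) (app_liftFun r).symm (app_liftFun r').symm)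
        (map_add _ _ _).symm

lemma isBody_lift (r : Γ(C.bosonic, C.bosonicι ⁻¹ᵁ W)) : 𝒜.IsBody (𝒜.lift W r) :=
  (𝒜.exists_isBody_app_eq r).choose_spec.1

lemma app_lift (r : Γ(C.bosonic, C.bosonicι ⁻¹ᵁ W)) : C.bosonicι.app W (𝒜.lift W r) = r :=
  (𝒜.exists_isBody_app_eq r).choose_spec.2

lemma lift_comp_app : 𝒜.lift W ≫ C.bosonicι.app W = 𝟙 _ := by
  ext r; exact app_lift r

lemma lift_res {V : C.even.Opens} (h : V ≤ W) :
    𝒜.lift W ≫ C.even.presheaf.map (homOfLE h).op = C.bosonic.presheaf.map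
      (homOfLE (show C.bosonicι ⁻¹ᵁ V ≤ C.bosonicι ⁻¹ᵁ W from fun _ hx => h hx)).op ≫ 𝒜.lift V := by
  ext r
  refine ((isBody_lift r).res h).ext (isBody_lift _) ?_
  rw [bosonicι_app_res, app_lift]
  exact (app_lift _).symm

end SplitAtlas

end SuperScheme

/-! ### The retraction defined by a section of restriction along a homeomorphism -/

namespace AlgebraicGeometry

lemma Scheme.Hom.appLE_comp_app_eq {X Y S : Scheme.{u}} {i : X ⟶ Y} {g g' : Y ⟶ S}
    (h : i ≫ g = i ≫ g') (V : S.Opens) (W : Y.Opens) (hW : W ≤ g ⁻¹ᵁ V) (hW' : W ≤ g' ⁻¹ᵁ V) :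
    g.appLE V W hW ≫ i.app W = g'.appLE V W hW' ≫ i.app W := by
  have key (k k' : X ⟶ S) (hk : k = k') (U : X.Opens) (e : U ≤ k ⁻¹ᵁ V) (e' : U ≤ k' ⁻¹ᵁ V) :
      k.appLE V U e = k'.appLE V U e' := by
    subst hk; rfl
  simp only [Scheme.Hom.app_eq_appLE, Scheme.Hom.appLE_comp_appLE]
  exact key _ _ h _ _ _

/-- A section of the restriction of functions along a homeomorphism `i : X ⟶ Y` of schemes. -/
structure HomeoSection {X Y : Scheme.{u}} (i : X ⟶ Y) where
  isHomeomorph : IsHomeomorph i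
  lift (W : Y.Opens) : Γ(X, i ⁻¹ᵁ W) ⟶ Γ(Y, W)
  lift_app (W : Y.Opens) : lift W ≫ i.app W = 𝟙 _
  lift_res {V W : Y.Opens} (h : V ≤ W) : lift W ≫ Y.presheaf.map (homOfLE h).op
    = X.presheaf.map (homOfLE (show i ⁻¹ᵁ V ≤ i ⁻¹ᵁ W from fun _ hx => h hx)).op ≫ lift V

namespace HomeoSection

variable {X Y : Scheme.{u}} {i : X ⟶ Y} (σ : HomeoSection i)

/-- The inverse of the homeomorphism `i`. -/
def homeo : Y ≃ₜ X := (σ.isHomeomorph.homeomorph i).symm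

@[simp] lemma map_homeo (y : Y) : i (σ.homeo y) = y :=
  (σ.isHomeomorph.homeomorph i).apply_symm_apply y

@[simp] lemma homeo_map (x : X) : σ.homeo (i x) = x :=
  (σ.isHomeomorph.homeomorph i).symm_apply_apply x

/-- The preimage of an open set under the inverse of the homeomorphism `i`. -/
def pre (V : X.Opens) : Y.Opens := (Opens.map (TopCat.ofHom ⟨σ.homeo, σ.homeo.continuous⟩)).obj V

lemma mem_pre {V : X.Opens} {y : Y} : y ∈ σ.pre V ↔ σ.homeo y ∈ V := Iff.rfl

lemma preimage_pre (V : X.Opens) : i ⁻¹ᵁ σ.pre V = V := by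
  ext x
  change σ.homeo (i x) ∈ V ↔ _
  simp

/-- The map on functions of the retraction. -/
def appHom (V : X.Opens) : Γ(X, V) ⟶ Γ(Y, σ.pre V) :=
  X.presheaf.map (homOfLE (σ.preimage_pre V).le).op ≫ σ.lift (σ.pre V)

lemma appHom_app (V : X.Opens) : σ.appHom V ≫ i.app (σ.pre V)
    = X.presheaf.map (homOfLE (σ.preimage_pre V).le).op := by
  rw [appHom, Category.assoc, lift_app, Category.comp_id]

lemma appHom_res {V V' : X.Opens} (h : V' ≤ V) (h' : σ.pre V' ≤ σ.pre V) :
    X.presheaf.map (homOfLE h).op ≫ σ.appHom V' = σ.appHom V ≫ Y.presheaf.map (homOfLE h').op := by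
  rw [appHom, appHom, Category.assoc, lift_res, ← Functor.map_comp_assoc, ← Functor.map_comp_assoc]
  rfl

lemma app_res_appHom {V : X.Opens} {W : Y.Opens} (j : W ⟶ σ.pre V) (s : Γ(X, V)) :
    i.app W (Y.presheaf.map j.op (σ.appHom V s)) = X.presheaf.map
      (homOfLE (show i ⁻¹ᵁ W ≤ V from fun x hx => by
        have h := leOfHom j (show i x ∈ W from hx); rwa [mem_pre, homeo_map] at h)).op s := by
  have h1 := congrArg (X.presheaf.map
    (homOfLE (show i ⁻¹ᵁ W ≤ i ⁻¹ᵁ σ.pre V from fun _ hx => leOfHom j hx)).op)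
    (congrArg (fun k => k s) (σ.appHom_app V))
  refine Eq.trans ?_ (h1.trans (X.presheaf_map_map _ _ _ _))
  exact congrArg (fun k => k (σ.appHom V s)) (i.naturality j.op)

/-- The retraction as a morphism of ringed spaces. -/
def pshHom : Y.toPresheafedSpace.Hom X.toPresheafedSpace where
  base := TopCat.ofHom ⟨σ.homeo, σ.homeo.continuous⟩
  c :=
    { app V := σ.appHom V.unop
      naturality _ _ j := σ.appHom_res j.unop.le _ }

/-- The retraction of `i` defined by a section of the restriction of functions. -/
def retraction : Y ⟶ X where
  __ := σ.pshHom
  prop y := ⟨fun a ha => by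
    -- Locality on stalks: if the pullback of `s` is invertible at `y`, it is invertible on a
    -- neighbourhood `W`. Restricting back along `i` recovers `s`, which is therefore invertible at
    -- the image of `y`.
    obtain ⟨V, hV, s, rfl⟩ := X.presheaf.exists_germ_eq a
    have h1 : IsUnit (Y.presheaf.germ (σ.pre V) y hV (σ.appHom V s)) := by
      have := PresheafedSpace.stalkMap_germ_apply σ.pshHom V y hV s
      exact this ▸ ha
    obtain ⟨W, j, hW, h2⟩ := Y.toRingedSpace.isUnit_res_of_isUnit_germ _ _ _ _ h1
    have h3 := h2.map (i.app W).hom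
    have hx : σ.homeo y ∈ i ⁻¹ᵁ W := by
      change i (σ.homeo y) ∈ W
      rwa [map_homeo]
    have h4 := h3.map (X.presheaf.germ _ _ hx).hom
    have h7 : IsUnit (X.presheaf.germ _ _ hx (i.app W (Y.presheaf.map j.op (σ.appHom V s)))) := h4
    rw [app_res_appHom, TopCat.Presheaf.germ_res_apply] at h7
    exact h7⟩

lemma preimage_retraction (V : X.Opens) : i ⁻¹ᵁ σ.retraction ⁻¹ᵁ V = V := σ.preimage_pre V

lemma retraction_preimage (W : Y.Opens) : σ.retraction ⁻¹ᵁ i ⁻¹ᵁ W = W := by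
  ext y
  change i (σ.homeo y) ∈ W ↔ _
  simp

lemma isHomeomorph_retraction : IsHomeomorph σ.retraction := σ.homeo.isHomeomorph

lemma comp_retraction : i ≫ σ.retraction = 𝟙 X := by
  refine Scheme.Hom.ext (by ext x; exact σ.homeo_map x) fun V => ?_
  rw [Scheme.Hom.comp_app]
  change (σ.appHom V ≫ i.app (σ.pre V)) ≫ _ = _
  rw [appHom_app]
  exact (X.presheaf.map_comp _ _).symm.trans (X.presheaf.map_id _)

end HomeoSection

end AlgebraicGeometry

/-! ### The projection onto the even part -/

namespace SuperScheme.SplitAtlas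

variable {C : SuperScheme.{u}} {S : Scheme.{u}} {f : C.even ⟶ S} (𝒜 : SplitAtlas f)

/-- The section of the restriction of functions to the even closed subscheme. -/
def bodySection : HomeoSection C.bosonicι where
  isHomeomorph := isHomeomorph_bosonicι 𝒜.rank
  lift := 𝒜.lift
  lift_app _ := lift_comp_app
  lift_res := lift_res

/-- The projection of a split supercurve to its even part. -/
def proj : C.even ⟶ C.bosonic := 𝒜.bodySection.retraction

lemma isHomeomorph_proj : IsHomeomorph 𝒜.proj := 𝒜.bodySection.isHomeomorph_retraction

lemma preimage_proj (V : C.bosonic.Opens) : C.bosonicι ⁻¹ᵁ 𝒜.proj ⁻¹ᵁ V = V :=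
  𝒜.bodySection.preimage_retraction V

lemma proj_preimage (W : C.even.Opens) : 𝒜.proj ⁻¹ᵁ C.bosonicι ⁻¹ᵁ W = W :=
  𝒜.bodySection.retraction_preimage W

lemma bosonicι_proj : C.bosonicι ≫ 𝒜.proj = 𝟙 _ := 𝒜.bodySection.comp_retraction

lemma isBody_proj (V : C.bosonic.Opens) (r : Γ(C.bosonic, V)) : 𝒜.IsBody (𝒜.proj.app V r) :=
  isBody_lift _

lemma app_proj (V : C.bosonic.Opens) (r : Γ(C.bosonic, V)) :
    C.bosonicι.app (𝒜.proj ⁻¹ᵁ V) (𝒜.proj.app V r)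
      = C.bosonic.presheaf.map (homOfLE (𝒜.preimage_proj V).le).op r :=
  app_lift _

lemma proj_app_injective (V : C.bosonic.Opens) : Function.Injective (𝒜.proj.app V) := by
  intro r r' h
  have h1 := congrArg (C.bosonicι.app (𝒜.proj ⁻¹ᵁ V)) h
  rw [app_proj, app_proj] at h1
  have h2 := congrArg (C.bosonic.presheaf.map (homOfLE (𝒜.preimage_proj V).ge).op) h1
  rw [C.bosonic.presheaf_map_map _ _ (𝟙 _), C.bosonic.presheaf_map_map _ _ (𝟙 _),
    CategoryTheory.Functor.map_id] at h2
  exact h2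

variable {𝒜}

lemma IsBody.exists_proj_app_eq {V : C.bosonic.Opens} {b : Γ(C.even, 𝒜.proj ⁻¹ᵁ V)}
    (hb : 𝒜.IsBody b) : ∃ r, 𝒜.proj.app V r = b := by
  refine ⟨C.bosonic.presheaf.map (homOfLE (𝒜.preimage_proj V).ge).op
    (C.bosonicι.app (𝒜.proj ⁻¹ᵁ V) b), (𝒜.isBody_proj V _).ext hb ?_⟩
  rw [app_proj, C.bosonic.presheaf_map_map _ _ (𝟙 _), CategoryTheory.Functor.map_id]
  rfl

variable (𝒜)

/-- Functions pulled back from `S` are killed by the relative derivatives `∂_θ`, hence coincide with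
the lifts of their restrictions to `C₀`. -/
lemma proj_comp : 𝒜.proj ≫ C.bosonicι ≫ f = f := by
  refine Scheme.Hom.ext (by ext x; exact congrArg f (𝒜.bodySection.map_homeo x)) fun V => ?_
  ext s
  refine IsBody.ext (𝒜 := 𝒜) (W := f ⁻¹ᵁ V) ?_ ?_ ?_
  · exact IsBody.res (𝒜 := 𝒜) _ (𝒜.isBody_proj _ _)
  · have := isBody_base (𝒜 := 𝒜) V le_rfl s
    rwa [← Scheme.Hom.app_eq_appLE] at this
  · have h1 := Scheme.Hom.appLE_comp_app_eq (i := C.bosonicι) (g := 𝒜.proj ≫ C.bosonicι ≫ f) (g' := f)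
      (by rw [← Category.assoc, 𝒜.bosonicι_proj, Category.id_comp]) V (f ⁻¹ᵁ V) (fun x hx => by
        change f (C.bosonicι (𝒜.proj x)) ∈ V
        rwa [show C.bosonicι (𝒜.proj x) = x from 𝒜.bodySection.map_homeo x]) le_rfl
    rw [← Scheme.Hom.app_eq_appLE] at h1
    exact congrArg (fun k => k s) h1

end SuperScheme.SplitAtlas

/-! ### Smoothness of the even part -/

namespace SuperScheme

variable {C : SuperScheme.{u}} {S : Scheme.{u}} {f : C.even ⟶ S}

/-- The products of odd functions generate the ideal of `θ¹θ²`, and modulo it `A[θ¹, θ²]` has even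
part `A`. So the smooth algebra of the local model is the ring of functions on the corresponding
piece of `C₀`. -/
lemma bijective_comp_bosonicι (hC : C.IsOddRankTwo) {U : C.even.Opens} (hU : IsAffineOpen U)
    {A : CommRingCat.{u}} (σ : A ⟶ Γ(C.even, U)) (θ : Fin 2 → Γ(C.odd, U))
    (heven : Function.Bijective (fun ab : A × A => σ ab.1 + σ ab.2 * C.mul U (θ 0) (θ 1)))
    (hodd : Function.Surjective (fun ab : A × A => σ ab.1 • θ 0 + σ ab.2 • θ 1)) :
    Function.Bijective (σ ≫ C.bosonicι.app U) := by
  have hpt (x y : Γ(C.odd, U)) : C.bosonicι.app U (C.mul U x y) = 0 := C.isPoint_bosonicι U x y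
  constructor
  · rw [injective_iff_map_eq_zero]
    intro a ha
    have h1 : σ a ∈ Ideal.span {C.mul U (θ 0) (θ 1)} := by
      refine Ideal.span_le.2 ?_ ((bosonicι_app_eq_zero_iff hU).1 ha)
      rintro _ ⟨⟨x, y⟩, rfl⟩
      obtain ⟨⟨a₀, a₁⟩, rfl⟩ := hodd x
      obtain ⟨⟨b₀, b₁⟩, rfl⟩ := hodd y
      refine Ideal.mem_span_singleton'.2 ⟨σ a₀ * σ b₁ - σ a₁ * σ b₀, ?_⟩
      simp only [oddAdd_mul, oddMul_add, smul_oddMul, oddMul_smul, hC.oddMul_self]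
      rw [C.mul_comm U (θ 1) (θ 0)]
      ring
    obtain ⟨r, hr⟩ := Ideal.mem_span_singleton'.1 h1
    obtain ⟨⟨b, c⟩, rfl⟩ := heven.2 r
    -- Since `(θ¹θ²)² = 0`, the relation reads `σ a = σ b · θ¹θ²`, and coefficients in the local
    -- model are unique.
    have h2 : (a, (0 : A)) = (0, b) := heven.1 <| by
      dsimp only
      rw [← hr, map_zero, zero_mul, add_zero, zero_add, add_mul, _root_.mul_assoc,
        hC.oddMul_mul_oddMul, mul_zero, add_zero]
    exact congrArg Prod.fst h2
  · intro r
    obtain ⟨a, rfl⟩ := bosonicι_app_surjective hU r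
    obtain ⟨⟨b, c⟩, rfl⟩ := heven.2 a
    refine ⟨b, ?_⟩
    dsimp only
    rw [map_add, map_mul, hpt, mul_zero, add_zero]
    rfl

lemma IsSmoothCurve12.smoothOfRelativeDimension (hf : IsSmoothCurve12 f) (hC : C.IsOddRankTwo) :
    SmoothOfRelativeDimension 1 (C.bosonicι ≫ f) where
  exists_isStandardSmoothOfRelativeDimension x := by
    obtain ⟨U, V, h, hx, hU, hV, A, φ, σ, θ, hφ, hσ, heven, hodd⟩ := hf (C.bosonicι x)
    refine ⟨V, hV, C.bosonicι ⁻¹ᵁ U, hU.preimage _, hx, fun y hy => h hy, ?_⟩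
    have h1 : (C.bosonicι ≫ f).appLE V (C.bosonicι ⁻¹ᵁ U) (fun y hy => h hy)
        = φ ≫ σ ≫ C.bosonicι.app U := by
      rw [← Category.assoc, hσ, Scheme.Hom.app_eq_appLE, Scheme.Hom.appLE_comp_appLE]
    rw [h1]
    exact (RingHom.isStandardSmoothOfRelativeDimension_respectsIso (n := 1)).1 φ.hom
      (RingEquiv.ofBijective _ (bijective_comp_bosonicι hC hU σ θ heven hodd.2)) hφ

end SuperScheme

/-! ### Differentials of rank one and exterior algebras on two generators -/

open scoped KaehlerDifferential in
/-- A surjection onto the ring from the module of differentials of a smooth algebra of relative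
dimension one is injective. -/
lemma KaehlerDifferential.injective_of_surjective {R S : Type u} [CommRing R] [CommRing S]
    [Algebra R S]
    (h : RingHom.Locally (RingHom.IsStandardSmoothOfRelativeDimension 1) (algebraMap R S))
    (F : Ω[S⁄R] →ₗ[S] S) (hF : Function.Surjective F) : Function.Injective F := by
  obtain ⟨s, hs, h⟩ := h
  refine injective_of_isLocalized_span s hs (fun t : s => Ω[Localization.Away t.1⁄R])
    (fun t => KaehlerDifferential.map R R S _) (fun t : s => Localization.Away t.1)
    (fun t => Algebra.linearMap S _) F fun t => ?_
  have hst : Algebra.IsStandardSmoothOfRelativeDimension 1 R (Localization.Away t.1) := by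
    rw [← RingHom.isStandardSmoothOfRelativeDimension_algebraMap]
    exact h t.1 t.2
  rcases subsingleton_or_nontrivial (Localization.Away t.1) with hT | hT
  · have : Subsingleton Ω[Localization.Away t.1⁄R] := Module.subsingleton (Localization.Away t.1) _
    exact Function.injective_of_subsingleton _
  have hsm : Algebra.IsStandardSmooth R (Localization.Away t.1) := hst.isStandardSmooth
  have hrank : Module.finrank (Localization.Away t.1) Ω[Localization.Away t.1⁄R] = 1 :=
    Module.finrank_eq_of_rank_eq
      (Algebra.IsStandardSmoothOfRelativeDimension.rank_kaehlerDifferential 1)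
  let G := IsLocalizedModule.mapExtendScalars (.powers t.1)
    (KaehlerDifferential.map R R S (Localization.Away t.1)) 
    (Algebra.linearMap S (Localization.Away t.1)) (Localization.Away t.1) F
  have hG : Function.Surjective G := IsLocalizedModule.map_surjective _ _ _ _ hF
  obtain ⟨b⟩ := finrank_eq_one_iff Unit |>.1 hrank
  let e := b.equivFun.trans (LinearEquiv.funUnique Unit _ (Localization.Away t.1))
  -- After localization `Ω` is free of rank one, so a basis turns `G` into a surjective endomorphism
  -- of the ring as a module over itself, which is injective.
  have h1 : Function.Injective (G ∘ₗ e.symm.toLinearMap) :=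
    OrzechProperty.injective_of_surjective_endomorphism _ (hG.comp e.symm.surjective)
  have h2 : Function.Injective G := by
    intro x y hxy
    apply e.injective
    apply h1
    simpa using hxy
  exact h2

section Exterior

variable {R M : Type*} [CommRing R] [AddCommGroup M] [Module R M] {e : Fin 2 → M}

lemma ExteriorAlgebra.ι_mul_ι_linearCombination (x y : M) (a b c d : R) :
    ExteriorAlgebra.ι R (a • x + b • y) * ExteriorAlgebra.ι R (c • x + d • y)
      = (a * d - b * c) • (ExteriorAlgebra.ι R x * ExteriorAlgebra.ι R y) := by
  have h : ExteriorAlgebra.ι R y * ExteriorAlgebra.ι R x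
      = -(ExteriorAlgebra.ι R x * ExteriorAlgebra.ι R y) :=
    eq_neg_of_add_eq_zero_left (ExteriorAlgebra.ι_add_mul_swap y x)
  simp only [map_add, map_smul, add_mul, mul_add, smul_mul_smul_comm, ExteriorAlgebra.ι_sq_zero, h]
  module

lemma exteriorPower.exists_eq_smul_ιMulti
    (he : Function.Surjective fun ab : R × R => ab.1 • e 0 + ab.2 • e 1) (x : ⋀[R]^2 M) :
    ∃ r : R, x = r • exteriorPower.ιMulti R 2 e := by
  have hx : x ∈ Submodule.span R (Set.range (exteriorPower.ιMulti R 2 (M := M))) := by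
    rw [exteriorPower.ιMulti_span]; trivial
  induction hx using Submodule.span_induction with
  | mem x hx =>
    obtain ⟨v, rfl⟩ := hx
    obtain ⟨⟨a, b⟩, h0⟩ := he (v 0)
    obtain ⟨⟨c, d⟩, h1⟩ := he (v 1)
    refine ⟨a * d - b * c, Subtype.ext ?_⟩
    simp only [Submodule.coe_smul, exteriorPower.ιMulti_apply_coe, ExteriorAlgebra.ιMulti_apply,
      List.ofFn_succ, List.ofFn_zero, List.prod_cons, List.prod_nil, mul_one]
    rw [← ExteriorAlgebra.ι_mul_ι_linearCombination]
    exact congrArg₂ (· * ·) (congrArg _ h0.symm) (congrArg _ h1.symm)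
  | zero => exact ⟨0, (zero_smul _ _).symm⟩
  | add x y _ _ hx hy =>
    obtain ⟨r, rfl⟩ := hx
    obtain ⟨s, rfl⟩ := hy
    exact ⟨r + s, (add_smul _ _ _).symm⟩
  | smul a x _ hx =>
    obtain ⟨r, rfl⟩ := hx
    exact ⟨a * r, (mul_smul _ _ _).symm⟩

/-- Only generation by `e` is used. Uniqueness of the normal form is not needed, since injectivity
of `exteriorHom` is checked directly on such expressions. -/
lemma ExteriorAlgebra.exists_eq
    (he : Function.Surjective fun ab : R × R => ab.1 • e 0 + ab.2 • e 1) (x : ExteriorAlgebra R M) :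
    ∃ (r s : R) (m : M), x = algebraMap R _ r + ExteriorAlgebra.ι R m
      + s • (ExteriorAlgebra.ι R (e 0) * ExteriorAlgebra.ι R (e 1)) := by
  induction x using CliffordAlgebra.left_induction with
  | algebraMap r => exact ⟨r, 0, 0, by rw [map_zero, zero_smul, add_zero, add_zero]⟩
  | add x y hx hy =>
    obtain ⟨r, s, m, rfl⟩ := hx
    obtain ⟨r', s', m', rfl⟩ := hy
    exact ⟨r + r', s + s', m + m', by rw [map_add, map_add, add_smul]; abel⟩
  | ι_mul x m hx =>
    obtain ⟨r, s, m', rfl⟩ := hx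
    obtain ⟨⟨a, b⟩, rfl⟩ := he m
    obtain ⟨⟨c, d⟩, rfl⟩ := he m'
    refine ⟨0, a * d - b * c, r • (a • e 0 + b • e 1), ?_⟩
    have h3 : ExteriorAlgebra.ι R (a • e 0 + b • e 1)
        * (ExteriorAlgebra.ι R (e 0) * ExteriorAlgebra.ι R (e 1)) = 0 := by
      have h1 := ExteriorAlgebra.ι_mul_ι_linearCombination (e 0) (e 1) a b 1 0
      rw [one_smul, zero_smul, add_zero] at h1
      rw [← mul_assoc, h1, smul_mul_assoc, mul_assoc, ExteriorAlgebra.ι_sq_zero, mul_zero,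
        mul_zero, smul_zero]
    change ExteriorAlgebra.ι R _ * _ = _
    rw [mul_add, mul_add, mul_smul_comm, h3, smul_zero, add_zero,
      ExteriorAlgebra.ι_mul_ι_linearCombination, map_smul, map_zero, zero_add,
      ← Algebra.commutes, ← Algebra.smul_def]

end Exterior

/-! ### The bundle of odd functions -/

namespace SuperScheme

variable {C : SuperScheme.{u}} {S : Scheme.{u}} {f : C.even ⟶ S}

lemma IsOddRankTwo.oddMul_linearCombination (hC : C.IsOddRankTwo) {W : C.even.Opens}
    (a b c d : Γ(C.even, W)) (x y : Γ(C.odd, W)) :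
    C.mul W (a • x + b • y) (c • x + d • y) = (a * d - b * c) * C.mul W x y := by
  simp only [oddAdd_mul, oddMul_add, smul_oddMul, oddMul_smul, hC.oddMul_self]
  rw [C.mul_comm W y x]
  ring

namespace Coord

variable {U W : C.even.Opens} (φ : Coord f U) (h : W ≤ U)

/-- The determinant of a pair of odd functions with respect to the odd coordinates. -/
def oddDet (x : Fin 2 → Γ(C.odd, W)) : Γ(C.even, W) :=
  (φ.dθ 0).d1 W h (x 0) * (φ.dθ 1).d1 W h (x 1) - (φ.dθ 1).d1 W h (x 0) * (φ.dθ 0).d1 W h (x 1)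

variable (hC : C.IsOddRankTwo)
include hC

lemma oddMul_eq_oddDet (x : Fin 2 → Γ(C.odd, W)) :
    C.mul W (x 0) (x 1) = φ.oddDet h x * φ.vol h := φ.oddMul_eq h hC _ _

lemma isBody_oddDet (x : Fin 2 → Γ(C.odd, W)) : φ.IsBody h (φ.oddDet h x) :=
  ((φ.isBody_dθ h hC _ _).mul (φ.isBody_dθ h hC _ _)).sub
    ((φ.isBody_dθ h hC _ _).mul (φ.isBody_dθ h hC _ _))

end Coord

namespace SplitAtlas

variable (𝒜 : SplitAtlas f) {W : C.even.Opens}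

/-- A pair of odd functions that is locally a basis of the odd functions. -/
def IsOddFrame (x : Fin 2 → Γ(C.odd, W)) : Prop :=
  ∀ i (V : C.even.Opens) (hV : V ≤ W) (h : V ≤ 𝒜.U i),
    IsUnit ((𝒜.φ i).oddDet h fun j => C.resO hV (x j))

variable {𝒜}

namespace IsOddFrame

variable {x : Fin 2 → Γ(C.odd, W)} (hx : 𝒜.IsOddFrame x)
include hx

lemma res {V : C.even.Opens} (hV : V ≤ W) : 𝒜.IsOddFrame fun j => C.resO hV (x j) :=
  fun i V' hV' h => by simpa using hx i V' (hV'.trans hV) h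

lemma eq_zero {t : Γ(C.even, W)} (ht : 𝒜.IsBody t) (h0 : t * C.mul W (x 0) (x 1) = 0) : t = 0 := by
  refine even_ext fun w hw => ?_
  obtain ⟨V, hV, i, hi, -, hwV⟩ := 𝒜.exists_chart hw
  refine ⟨V, hV, hwV, ?_⟩
  have hu := hx i V hV hi
  have h1 := congrArg (C.resE hV) h0
  rw [resE_mul, resE_oddMul, (𝒜.φ i).oddMul_eq_oddDet hi 𝒜.rank fun j => C.resO hV (x j),
    ← _root_.mul_assoc, resE_zero] at h1
  have h2 := Coord.IsBody.mul_vol_injective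
    ((ht i V hV hi).mul ((𝒜.φ i).isBody_oddDet hi 𝒜.rank fun j => C.resO hV (x j)))
    Coord.isBody_zero (h1.trans (zero_mul _).symm)
  rw [resE_zero]
  exact (hu.mul_left_eq_zero).1 h2

lemma ext {t t' : Γ(C.even, W)} (ht : 𝒜.IsBody t) (ht' : 𝒜.IsBody t')
    (h : t * C.mul W (x 0) (x 1) = t' * C.mul W (x 0) (x 1)) : t = t' := by
  rw [← sub_eq_zero] at h ⊢
  rw [← sub_mul] at h
  exact hx.eq_zero (ht.sub ht') h

lemma exists_eq_of_le {i : 𝒜.ι} (hi : W ≤ 𝒜.U i) {n : Γ(C.even, W)}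
    (hn : C.bosonicι.app W n = 0) : ∃ t, 𝒜.IsBody t ∧ n = t * C.mul W (x 0) (x 1) := by
  have hC := 𝒜.rank
  have hu := hx i W le_rfl hi
  simp only [resO_self] at hu
  obtain ⟨d, hd⟩ := hu.exists_left_inv
  rw [(𝒜.φ i).bosonicι_app_eq_zero_iff hi hC] at hn
  -- The inverse `d` of the determinant is replaced by its part free of `θ`, which is still an
  -- inverse after multiplication by `θ¹θ²`.
  refine ⟨(𝒜.φ i).top hi n * (d - (𝒜.φ i).top hi d * (𝒜.φ i).vol hi), (isBody_iff hi).2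
    (((𝒜.φ i).isBody_top hi hC n).mul ((𝒜.φ i).isBody_sub_top hi hC d)), ?_⟩
  conv_lhs => rw [hn]
  rw [(𝒜.φ i).oddMul_eq_oddDet hi hC]
  linear_combination (-(𝒜.φ i).top hi n * (𝒜.φ i).vol hi) * hd
    + (𝒜.φ i).top hi n * (𝒜.φ i).top hi d * (𝒜.φ i).oddDet hi x * (𝒜.φ i).vol_mul_vol hi hC

lemma exists_eq {n : Γ(C.even, W)} (hn : C.bosonicι.app W n = 0) :
    ∃ t, 𝒜.IsBody t ∧ n = t * C.mul W (x 0) (x 1) := by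
  have hloc (V : {V : C.even.Opens // V ≤ W ∧ ∃ i, V ≤ 𝒜.U i}) :
      ∃ t : Γ(C.even, V.1), 𝒜.IsBody t ∧ C.resE V.2.1 n
        = t * C.mul V.1 (C.resO V.2.1 (x 0)) (C.resO V.2.1 (x 1)) := by
    obtain ⟨V, hV, i, hi⟩ := V
    refine (hx.res hV).exists_eq_of_le hi ?_
    rw [bosonicι_app_res, hn, map_zero]
  choose t ht hnt using hloc
  have hcov : ∀ w ∈ W, ∃ V : {V : C.even.Opens // V ≤ W ∧ ∃ i, V ≤ 𝒜.U i}, w ∈ V.1 :=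
    fun w hw => by
      obtain ⟨V, hV, i, hi, -, hwV⟩ := 𝒜.exists_chart hw
      exact ⟨⟨V, hV, i, hi⟩, hwV⟩
  obtain ⟨b, hb⟩ := exists_even_glue (fun V : {V : C.even.Opens // V ≤ W ∧ ∃ i, V ≤ 𝒜.U i} => V.1)
    (fun V => V.2.1) hcov t fun V V' => by
      refine (hx.res (inf_le_left.trans V.2.1)).ext ((ht V).res _) ((ht V').res _) ?_
      have h1 := congrArg (C.resE (inf_le_left : V.1 ⊓ V'.1 ≤ V.1)) (hnt V)
      have h2 := congrArg (C.resE (inf_le_right : V.1 ⊓ V'.1 ≤ V'.1)) (hnt V')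
      simp only [resE_resE, resE_mul, resE_oddMul, resO_resO] at h1 h2
      exact h1.symm.trans h2
  refine ⟨b, isBody_of_locally fun w hw => ?_, even_ext fun w hw => ?_⟩ <;>
    obtain ⟨V, hwV⟩ := hcov w hw
  · exact ⟨V.1, V.2.1, hwV, hb V ▸ ht V⟩
  · refine ⟨V.1, V.2.1, hwV, ?_⟩
    rw [resE_mul, hb, resE_oddMul, hnt]

end IsOddFrame

variable (𝒜)

/-- The odd functions as a module over the functions on the even part. -/
def bundle : C.bosonic.Modules := (Scheme.Modules.pushforward 𝒜.proj).obj C.odd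

variable {𝒜}

lemma isFrame_iff {U : C.bosonic.Opens} {e : Fin 2 → Γ(𝒜.bundle, U)} :
    IsFrame 𝒜.bundle U e ↔ ∀ (V : C.bosonic.Opens) (h : 𝒜.proj ⁻¹ᵁ V ≤ 𝒜.proj ⁻¹ᵁ U),
      V ≤ U → Function.Bijective fun ab : Γ(C.bosonic, V) × Γ(C.bosonic, V) =>
        𝒜.proj.app V ab.1 • C.resO h (e 0 : Γ(C.odd, 𝒜.proj ⁻¹ᵁ U))
          + 𝒜.proj.app V ab.2 • C.resO h (e 1 : Γ(C.odd, 𝒜.proj ⁻¹ᵁ U)) :=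
  ⟨fun H V _ hV => H V hV, fun H V hV => H V (fun _ hx => hV hx) hV⟩

/-- Expanding `θ¹, θ²` in the frame and comparing `θ¹θ²` with itself shows that the determinant of
the expansion is inverse to `oddDet`. -/
lemma isOddFrame_of_isFrame {U : C.bosonic.Opens} {e : Fin 2 → Γ(𝒜.bundle, U)}
    (he : IsFrame 𝒜.bundle U e) :
    𝒜.IsOddFrame (W := 𝒜.proj ⁻¹ᵁ U) e := by
  intro i V hV hi
  obtain ⟨V, rfl⟩ : ∃ V', V = 𝒜.proj ⁻¹ᵁ V' := ⟨_, (𝒜.proj_preimage V).symm⟩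
  have hVU : V ≤ U := fun x hx => by
    have := hV (show C.bosonicι x ∈ 𝒜.proj ⁻¹ᵁ V from (𝒜.preimage_proj V).ge hx)
    exact (𝒜.preimage_proj U).le this
  have hs := (isFrame_iff.1 he V hV hVU).2
  obtain ⟨⟨a, b⟩, hab⟩ := hs ((𝒜.φ i).θOn hi 0)
  obtain ⟨⟨c, d⟩, hcd⟩ := hs ((𝒜.φ i).θOn hi 1)
  have hb (r : Γ(C.bosonic, V)) : (𝒜.φ i).IsBody hi (𝒜.proj.app V r) :=
    (isBody_iff hi).1 (𝒜.isBody_proj V r)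
  have h1 : (𝒜.φ i).vol hi = _ := congrArg₂ (C.mul (𝒜.proj ⁻¹ᵁ V)) hab.symm hcd.symm
  rw [𝒜.rank.oddMul_linearCombination,
    (𝒜.φ i).oddMul_eq_oddDet hi 𝒜.rank (fun j => C.resO hV (e j)), ← _root_.mul_assoc] at h1
  refine IsUnit.of_mul_eq_one
    (𝒜.proj.app V a * 𝒜.proj.app V d - 𝒜.proj.app V b * 𝒜.proj.app V c) ?_
  rw [_root_.mul_comm]
  refine Eq.symm (Coord.IsBody.mul_vol_injective Coord.isBody_one
    ((((hb _).mul (hb _)).sub ((hb _).mul (hb _))).mul (Coord.isBody_oddDet _ _ 𝒜.rank _)) ?_)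
  rw [one_mul]
  exact h1

/-- Coefficients pulled back from `C₀` are killed by `∂_θ`, so applying `∂_{θʲ}` reads them off.
Conversely, the `∂_θ`-derivatives of an odd function are free of `θ` and thus come from `C₀`. -/
lemma isFrame_θ (i : 𝒜.ι) {U : C.bosonic.Opens} (hU : 𝒜.proj ⁻¹ᵁ U ≤ 𝒜.U i) :
    IsFrame 𝒜.bundle U fun j => (𝒜.φ i).θOn hU j := by
  refine isFrame_iff.2 ?_
  intro V h hVU
  have hi := h.trans hU
  have hb (r : Γ(C.bosonic, V)) : (𝒜.φ i).IsBody hi (𝒜.proj.app V r) :=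
    (isBody_iff hi).1 (𝒜.isBody_proj V r)
  have hdθ (a b : Γ(C.bosonic, V)) (j : Fin 2) : ((𝒜.φ i).dθ j).d1 _ hi
      (𝒜.proj.app V a • (𝒜.φ i).θOn hi 0 + 𝒜.proj.app V b • (𝒜.φ i).θOn hi 1)
      = if j = 0 then 𝒜.proj.app V a else 𝒜.proj.app V b := by
    rw [map_add, OddField.d1_smul, OddField.d1_smul, hb a j, hb b j, zero_oddMul, zero_oddMul,
      Coord.dθ_θOn, Coord.dθ_θOn]
    fin_cases j <;> simp
  simp only [resO_resO]
  constructor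
  · rintro ⟨a, b⟩ ⟨c, d⟩ hab
    refine Prod.ext (𝒜.proj_app_injective V ?_) (𝒜.proj_app_injective V ?_)
    · simpa only [hdθ, if_pos] using congrArg (((𝒜.φ i).dθ 0).d1 _ hi) hab
    · simpa only [hdθ, one_ne_zero, if_neg, if_false] using
        congrArg (((𝒜.φ i).dθ 1).d1 _ hi) hab
  · intro x
    obtain ⟨a, ha⟩ := ((isBody_iff hi).2 ((𝒜.φ i).isBody_dθ hi 𝒜.rank 0 x)).exists_proj_app_eq
    obtain ⟨b, hb⟩ := ((isBody_iff hi).2 ((𝒜.φ i).isBody_dθ hi 𝒜.rank 1 x)).exists_proj_app_eq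
    refine ⟨(a, b), ?_⟩
    dsimp only
    rw [ha, hb]
    exact ((𝒜.φ i).odd_eq hi 𝒜.rank x).symm

variable (𝒜)

lemma isRankTwoBundle : IsRankTwoBundle 𝒜.bundle := fun x => by
  obtain ⟨i, hi⟩ := 𝒜.cover (C.bosonicι x)
  exact ⟨C.bosonicι ⁻¹ᵁ 𝒜.U i, hi, _, 𝒜.isFrame_θ i (𝒜.proj_preimage _).le⟩

end SplitAtlas

end SuperScheme

/-! ### Functions on `C` as an exterior algebra -/

namespace SuperScheme

/-- The superalgebra of functions on an open set. -/
def Sections (C : SuperScheme.{u}) (W : C.even.Opens) : Type u := Γ(C.even, W) × Γ(C.odd, W)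

namespace Sections

variable {C : SuperScheme.{u}} {W : C.even.Opens}

/-- The function with given even and odd parts. -/
def mk (a : Γ(C.even, W)) (x : Γ(C.odd, W)) : C.Sections W := (a, x)

@[simp] lemma mk_fst (a : Γ(C.even, W)) (x : Γ(C.odd, W)) : (mk a x).1 = a := rfl
@[simp] lemma mk_snd (a : Γ(C.even, W)) (x : Γ(C.odd, W)) : (mk a x).2 = x := rfl

instance : AddCommGroup (C.Sections W) := inferInstanceAs (AddCommGroup (Γ(C.even, W) × Γ(C.odd, W)))

instance : Mul (C.Sections W) := ⟨C.mulSec W⟩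

instance : One (C.Sections W) := ⟨mk 1 0⟩

@[ext] lemma ext {s t : C.Sections W} (h₁ : s.1 = t.1) (h₂ : s.2 = t.2) : s = t := Prod.ext h₁ h₂

@[simp] lemma add_fst (s t : C.Sections W) : (s + t).1 = s.1 + t.1 := rfl
@[simp] lemma add_snd (s t : C.Sections W) : (s + t).2 = s.2 + t.2 := rfl
@[simp] lemma zero_fst : (0 : C.Sections W).1 = 0 := rfl
@[simp] lemma zero_snd : (0 : C.Sections W).2 = 0 := rfl
@[simp] lemma one_fst : (1 : C.Sections W).1 = 1 := rfl
@[simp] lemma one_snd : (1 : C.Sections W).2 = 0 := rfl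
@[simp] lemma mul_fst (s t : C.Sections W) : (s * t).1 = s.1 * t.1 + C.mul W s.2 t.2 := rfl
@[simp] lemma mul_snd (s t : C.Sections W) : (s * t).2 = s.1 • t.2 + t.1 • s.2 := rfl

instance : Ring (C.Sections W) where
  __ := (inferInstance : AddCommGroup (C.Sections W))
  left_distrib a b c := by
    ext
    · simp; ring
    · simp; module
  right_distrib a b c := by
    ext
    · simp; ring
    · simp; module
  zero_mul a := by ext <;> simp
  mul_zero a := by ext <;> simp
  one_mul a := by ext <;> simp
  mul_one a := by ext <;> simp
  mul_assoc a b c := by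
    ext
    · simp; ring
    · simp only [mul_fst, mul_snd, add_smul, C.mul_assoc W a.2 b.2 c.2]
      module

/-- The inclusion of the even functions, composed with a ring homomorphism. -/
def evenHom {B : Type u} [CommRing B] (g : B →+* Γ(C.even, W)) : B →+* C.Sections W where
  toFun b := mk (g b) 0
  map_one' := by ext <;> simp
  map_zero' := by ext <;> simp
  map_add' a b := by ext <;> simp
  map_mul' a b := by ext <;> simp

end Sections

namespace SplitAtlas

variable {C : SuperScheme.{u}} {S : Scheme.{u}} {f : C.even ⟶ S} (𝒜 : SplitAtlas f)
  (U : C.bosonic.Opens)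

instance : Algebra Γ(C.bosonic, U) (C.Sections (𝒜.proj ⁻¹ᵁ U)) :=
  (Sections.evenHom (𝒜.proj.app U).hom).toAlgebra' fun b x => by
    ext
    · exact congrArg₂ (· + ·) (_root_.mul_comm _ _)
        ((zero_oddMul x.2).trans (oddMul_zero x.2).symm)
    · exact _root_.add_comm _ _

variable {𝒜 U}

lemma algebraMap_sections (b : Γ(C.bosonic, U)) :
    algebraMap Γ(C.bosonic, U) (C.Sections (𝒜.proj ⁻¹ᵁ U)) b = Sections.mk (𝒜.proj.app U b) 0 := rfl

variable (𝒜 U)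

variable {𝒜 U} in
/-- A section of the bundle as an odd function. -/
def toOdd (m : Γ(𝒜.bundle, U)) : Γ(C.odd, 𝒜.proj ⁻¹ᵁ U) := m

variable {𝒜 U} in
lemma toOdd_add (m m' : Γ(𝒜.bundle, U)) : toOdd (m + m') = toOdd m + toOdd m' := rfl

variable {𝒜 U} in
lemma toOdd_smul (b : Γ(C.bosonic, U)) (m : Γ(𝒜.bundle, U)) :
    toOdd (b • m) = 𝒜.proj.app U b • toOdd m := rfl

/-- The inclusion of the odd functions. -/
def oddHom : Γ(𝒜.bundle, U) →ₗ[Γ(C.bosonic, U)] C.Sections (𝒜.proj ⁻¹ᵁ U) where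
  toFun x := Sections.mk 0 (toOdd x)
  map_add' x y := by
    ext <;> simp [toOdd_add]
  map_smul' b x := by
    rw [Algebra.smul_def, algebraMap_sections]
    ext <;> simp [toOdd_smul]

lemma oddHom_apply (m : Γ(𝒜.bundle, U)) : 𝒜.oddHom U m = Sections.mk 0 (toOdd m) := rfl

lemma oddHom_mul_self (m : Γ(𝒜.bundle, U)) : 𝒜.oddHom U m * 𝒜.oddHom U m = 0 := by
  rw [oddHom_apply]
  ext <;> simp [𝒜.rank.oddMul_self]

/-- The homomorphism from the exterior algebra of the odd functions. -/
def exteriorHom : ExteriorAlgebra Γ(C.bosonic, U) Γ(𝒜.bundle, U) →ₐ[Γ(C.bosonic, U)]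
    C.Sections (𝒜.proj ⁻¹ᵁ U) :=
  ExteriorAlgebra.lift _ ⟨𝒜.oddHom U, 𝒜.oddHom_mul_self U⟩

lemma exteriorHom_ι (m : Γ(𝒜.bundle, U)) :
    𝒜.exteriorHom U (ExteriorAlgebra.ι _ m) = 𝒜.oddHom U m := by
  rw [exteriorHom, ExteriorAlgebra.lift_ι_apply]

variable {U}

lemma exteriorHom_apply {e : Fin 2 → Γ(𝒜.bundle, U)} (r s : Γ(C.bosonic, U)) (m : Γ(𝒜.bundle, U)) :
    𝒜.exteriorHom U (algebraMap _ _ r + ExteriorAlgebra.ι _ m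
      + s • (ExteriorAlgebra.ι _ (e 0) * ExteriorAlgebra.ι _ (e 1)))
    = Sections.mk (𝒜.proj.app U r
      + 𝒜.proj.app U s * C.mul (𝒜.proj ⁻¹ᵁ U) (toOdd (e 0)) (toOdd (e 1))) (toOdd m) := by
  rw [map_add, map_add, map_smul, map_mul, AlgHom.commutes, exteriorHom_ι, exteriorHom_ι,
    exteriorHom_ι, Algebra.smul_def, algebraMap_sections, algebraMap_sections, oddHom_apply,
    oddHom_apply, oddHom_apply]
  ext <;> simp

variable {𝒜}

lemma IsFrame.bijective {e : Fin 2 → Γ(𝒜.bundle, U)} (he : IsFrame 𝒜.bundle U e) :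
    Function.Bijective fun ab : Γ(C.bosonic, U) × Γ(C.bosonic, U) =>
      ab.1 • e 0 + ab.2 • e 1 := by
  have h := he U le_rfl
  have h1 (m : Γ(𝒜.bundle, U)) : 𝒜.bundle.presheaf.map (homOfLE (le_refl U)).op m = m :=
    C.resO_self _ _
  simpa only [h1] using h

/-- The element `r + m + s e₀e₁` goes to the even part `r + s e₀e₁` and the odd part `m`.
Restriction to `C₀` determines `r`, and what remains of the even part is a unique multiple of
`e₀e₁`. -/
lemma bijective_exteriorHom (hU : IsTrivialOn 𝒜.bundle U) :
    Function.Bijective (𝒜.exteriorHom U) := by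
  obtain ⟨e, he⟩ := hU
  have hs := (IsFrame.bijective he).2
  have hx : 𝒜.IsOddFrame fun j => toOdd (e j) := 𝒜.isOddFrame_of_isFrame he
  constructor
  · rw [injective_iff_map_eq_zero]
    intro x h0
    obtain ⟨r, s, m, rfl⟩ := ExteriorAlgebra.exists_eq hs x
    rw [exteriorHom_apply] at h0
    have hm : m = 0 := congrArg Prod.snd h0
    have h1 : 𝒜.proj.app U r
        + 𝒜.proj.app U s * C.mul (𝒜.proj ⁻¹ᵁ U) (toOdd (e 0)) (toOdd (e 1)) = 0 :=
      congrArg Prod.fst h0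
    have hr : 𝒜.proj.app U r = 0 := by
      refine (𝒜.isBody_proj U r).eq_zero ?_
      have h2 := congrArg (C.bosonicι.app _) h1
      rwa [map_add, map_mul, C.isPoint_bosonicι, mul_zero, add_zero, map_zero] at h2
    rw [hr, zero_add] at h1
    have hs := hx.eq_zero (𝒜.isBody_proj U s) h1
    rw [hm, (injective_iff_map_eq_zero _).1 (𝒜.proj_app_injective U) r hr,
      (injective_iff_map_eq_zero _).1 (𝒜.proj_app_injective U) s hs]
    simp
  · rintro ⟨a, m⟩
    obtain ⟨r, hr⟩ := IsBody.exists_proj_app_eq (𝒜.isBody_lift (C.bosonicι.app _ a))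
    obtain ⟨t, ht, hat⟩ := hx.exists_eq (n := a - 𝒜.proj.app U r) (by
      rw [map_sub, hr, app_lift, sub_self])
    obtain ⟨s, rfl⟩ := ht.exists_proj_app_eq
    refine ⟨_, (𝒜.exteriorHom_apply (e := e) r s m).trans ?_⟩
    rw [← hat, add_sub_cancel]
    rfl

variable (𝒜)

/-- A supercurve with a split atlas is split. -/
def splitIso : SplitIso C C.bosonic 𝒜.bundle where
  p := 𝒜.proj
  homeo := 𝒜.isHomeomorph_proj
  inc U := AddMonoidHom.id Γ(C.odd, 𝒜.proj ⁻¹ᵁ U)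
  inc_res _ _ := rfl
  inc_smul _ _ _ := rfl
  bijective U _ hE :=
    ⟨(RingEquiv.ofBijective (𝒜.exteriorHom U) (bijective_exteriorHom hE)).toAddEquiv,
      (𝒜.exteriorHom U).commutes, fun e => 𝒜.exteriorHom_ι U e, map_mul (𝒜.exteriorHom U)⟩

end SplitAtlas

end SuperScheme

/-! ### The determinant of the bundle and the differentials -/

namespace SuperScheme.SplitAtlas

variable {C : SuperScheme.{u}} {S : Scheme.{u}} {f : C.even ⟶ S} {𝒜 : SplitAtlas f}

section Differential

variable {W : C.even.Opens}

lemma app_eq_zero_of_locally {n : Γ(C.even, W)} (H : ∀ w ∈ W, ∃ (V : C.even.Opens) (hV : V ≤ W),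
    w ∈ V ∧ C.bosonicι.app V (C.resE hV n) = 0) : C.bosonicι.app W n = 0 := by
  choose V hV hw h0 using H
  refine C.bosonic.sheaf.eq_of_locally_eq'
    (fun w : W => C.bosonicι ⁻¹ᵁ V w.1 w.2) _ (fun w => homOfLE fun _ hx => hV w.1 w.2 hx)
    (fun x hx => Opens.mem_iSup.2 ⟨⟨C.bosonicι x, hx⟩, hw _ hx⟩) _ _ fun w => ?_
  refine (bosonicι_app_res (hV w.1 w.2) n).symm.trans ((h0 w.1 w.2).trans (map_zero _).symm)

/-- The local sections `∂_z b · θ¹θ²` agree on overlaps by `dz_vol`, hence glue. -/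
lemma IsBody.exists_dvol {b : Γ(C.even, W)} (hb : 𝒜.IsBody b) :
    ∃ d : Γ(C.even, W), ∀ i (V : C.even.Opens) (hV : V ≤ W) (h : V ≤ 𝒜.U i),
      C.resE hV d = (𝒜.φ i).dz.d0 V h (C.resE hV b) * (𝒜.φ i).vol h := by
  have hcov : ∀ w ∈ W, ∃ V : {V : C.even.Opens × 𝒜.ι // V.1 ≤ W ∧ V.1 ≤ 𝒜.U V.2}, w ∈ V.1.1 :=
    fun w hw => by
      obtain ⟨V, hV, i, hi, -, hwV⟩ := 𝒜.exists_chart hw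
      exact ⟨⟨(V, i), hV, hi⟩, hwV⟩
  have hres (i j : 𝒜.ι) {V V' : C.even.Opens} (hV : V ≤ W) (hV' : V' ≤ V) (hi : V ≤ 𝒜.U i)
      (hj : V' ≤ 𝒜.U j) : C.resE hV' ((𝒜.φ i).dz.d0 V hi (C.resE hV b) * (𝒜.φ i).vol hi)
        = (𝒜.φ j).dz.d0 V' hj (C.resE (hV'.trans hV) b) * (𝒜.φ j).vol hj := by
    rw [resE_mul, Coord.vol_res, ← EvenField.d0_res, resE_resE,
      𝒜.dz_vol i j V' (hV'.trans hi) hj _ (hb i V' _ _)]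
  obtain ⟨d, hd⟩ := exists_even_glue
    (fun V : {V : C.even.Opens × 𝒜.ι // V.1 ≤ W ∧ V.1 ≤ 𝒜.U V.2} => V.1.1) (fun V => V.2.1) hcov
    (fun V => (𝒜.φ V.1.2).dz.d0 V.1.1 V.2.2 (C.resE V.2.1 b) * (𝒜.φ V.1.2).vol V.2.2)
    fun V V' => by
      rw [hres V.1.2 V'.1.2 _ _ _ (inf_le_right.trans V'.2.2), hres V'.1.2 V'.1.2]
  exact ⟨d, fun i V hV h => hd ⟨(V, i), hV, h⟩⟩

end Differential

variable (𝒜) (U : C.bosonic.Opens)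

/-- The functions on the preimage of an open set of the even part. -/
def Fn : Type u := Γ(C.even, 𝒜.proj ⁻¹ᵁ U)

instance : CommRing (𝒜.Fn U) := inferInstanceAs (CommRing Γ(C.even, 𝒜.proj ⁻¹ᵁ U))

instance : Algebra Γ(C.bosonic, U) (𝒜.Fn U) := (𝒜.proj.app U).hom.toAlgebra

variable {𝒜 U}

/-- The section `∂_z r · θ¹θ²`, which does not depend on the coordinates in the atlas. -/
def dvol (r : Γ(C.bosonic, U)) : 𝒜.Fn U := (𝒜.isBody_proj U r).exists_dvol.choose

lemma resE_dvol (r : Γ(C.bosonic, U)) (i : 𝒜.ι) (V : C.even.Opens) (hV : V ≤ 𝒜.proj ⁻¹ᵁ U)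
    (h : V ≤ 𝒜.U i) : C.resE hV (dvol (𝒜 := 𝒜) r)
      = (𝒜.φ i).dz.d0 V h (C.resE hV (𝒜.proj.app U r)) * (𝒜.φ i).vol h :=
  (𝒜.isBody_proj U r).exists_dvol.choose_spec i V hV h

lemma fn_ext {a b : 𝒜.Fn U} (H : ∀ (i : 𝒜.ι) (V : C.even.Opens) (hV : V ≤ 𝒜.proj ⁻¹ᵁ U),
    V ≤ 𝒜.U i → C.resE hV a = C.resE hV b) : a = b := by
  refine even_ext fun w hw => ?_
  obtain ⟨V, hV, i, hi, -, hwV⟩ := 𝒜.exists_chart hw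
  exact ⟨V, hV, hwV, H i V hV hi⟩

lemma resE_fn_add {V : C.even.Opens} (hV : V ≤ 𝒜.proj ⁻¹ᵁ U) (a b : 𝒜.Fn U) :
    C.resE hV (a + b : 𝒜.Fn U) = C.resE hV a + C.resE hV b := resE_add hV _ _

lemma resE_fn_smul {V : C.even.Opens} (hV : V ≤ 𝒜.proj ⁻¹ᵁ U) (r : Γ(C.bosonic, U))
    (a : 𝒜.Fn U) : C.resE hV (r • a : 𝒜.Fn U) = C.resE hV (𝒜.proj.app U r) * C.resE hV a :=
  resE_mul hV _ _

lemma dvol_add (r s : Γ(C.bosonic, U)) : dvol (𝒜 := 𝒜) (r + s) = dvol r + dvol s :=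
  fn_ext fun i V hV h => by
    rw [resE_fn_add]
    simp only [resE_dvol _ i V hV h, map_add, resE_add, add_mul]

lemma dvol_mul (r s : Γ(C.bosonic, U)) : dvol (𝒜 := 𝒜) (r * s) = r • dvol s + s • dvol r :=
  fn_ext fun i V hV h => by
    rw [resE_fn_add, resE_fn_smul, resE_fn_smul]
    simp only [resE_dvol _ i V hV h, map_mul, resE_mul, EvenField.d0_mul]
    ring

lemma proj_app_appLE (V : S.Opens) (hV : U ≤ (C.bosonicι ≫ f) ⁻¹ᵁ V)
    (hV' : 𝒜.proj ⁻¹ᵁ U ≤ f ⁻¹ᵁ V) (s : Γ(S, V)) :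
    𝒜.proj.app U ((C.bosonicι ≫ f).appLE V U hV s) = f.appLE V _ hV' s := by
  have key (k : C.even ⟶ S) (hk : k = f) (e : 𝒜.proj ⁻¹ᵁ U ≤ k ⁻¹ᵁ V) :
      k.appLE V (𝒜.proj ⁻¹ᵁ U) e = f.appLE V _ hV' := by
    subst hk; rfl
  rw [← key _ 𝒜.proj_comp fun x hx => hV hx, Scheme.Hom.app_eq_appLE, ← CommRingCat.comp_apply,
    Scheme.Hom.appLE_comp_appLE]

lemma dvol_base (V : S.Opens) (hV : U ≤ (C.bosonicι ≫ f) ⁻¹ᵁ V) (s : Γ(S, V)) :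
    dvol (𝒜 := 𝒜) ((C.bosonicι ≫ f).appLE V U hV s) = 0 :=
  fn_ext fun i W hW h => by
    have hV' : 𝒜.proj ⁻¹ᵁ U ≤ f ⁻¹ᵁ V := fun x hx => by
      have := hV hx
      rwa [← 𝒜.proj_comp]
    have h1 : C.resE hW (f.appLE V _ hV' s) = f.appLE V W (hW.trans hV') s := by
      rw [resE, ← CommRingCat.comp_apply, Scheme.Hom.appLE_map]
    rw [resE_dvol _ i W hW h, proj_app_appLE V hV hV' s, h1, EvenField.d0_base, zero_mul]
    exact (resE_zero hW).symm

lemma proj_app_res {U' : C.bosonic.Opens} (h : U' ≤ U) (h' : 𝒜.proj ⁻¹ᵁ U' ≤ 𝒜.proj ⁻¹ᵁ U)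
    (r : Γ(C.bosonic, U)) :
    𝒜.proj.app U' (C.bosonic.presheaf.map (homOfLE h).op r) = C.resE h' (𝒜.proj.app U r) :=
  congrArg (fun k => k r) (𝒜.proj.naturality (homOfLE h).op)

lemma dvol_res {U' : C.bosonic.Opens} (h : U' ≤ U) (h' : 𝒜.proj ⁻¹ᵁ U' ≤ 𝒜.proj ⁻¹ᵁ U)
    (r : Γ(C.bosonic, U)) : dvol (𝒜 := 𝒜) (C.bosonic.presheaf.map (homOfLE h).op r)
      = C.resE h' (dvol (𝒜 := 𝒜) r) :=
  fn_ext fun i V hV hi => by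
    rw [resE_dvol _ i V hV hi, proj_app_res h h', resE_resE]
    exact ((resE_resE hV h' _).trans (resE_dvol r i V (hV.trans h') hi)).symm

lemma app_dvol (r : Γ(C.bosonic, U)) : C.bosonicι.app _ (dvol (𝒜 := 𝒜) r) = 0 :=
  app_eq_zero_of_locally fun w hw => by
    obtain ⟨V, hV, i, hi, -, hwV⟩ := 𝒜.exists_chart hw
    refine ⟨V, hV, hwV, ?_⟩
    rw [resE_dvol r i V hV hi, map_mul, show C.bosonicι.app V ((𝒜.φ i).vol hi) = 0 from
      C.isPoint_bosonicι V _ _, mul_zero]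

end SuperScheme.SplitAtlas

lemma CommRingCat.KaehlerDifferential.span_range_d {A B : CommRingCat.{u}} (f : A ⟶ B) :
    Submodule.span B (Set.range (d (f := f))) = ⊤ := by
  let := f.hom.toAlgebra
  exact _root_.KaehlerDifferential.span_range_derivation A B

namespace CommRingCat.KaehlerDifferential

variable {A B A' B' : CommRingCat.{u}} {f : A ⟶ B} {f' : A' ⟶ B'} {g : A ⟶ A'} {g' : B ⟶ B'}
  (fac : g ≫ f' = f ≫ g')

/-- The map on differentials induced by a commutative square, as an additive map. -/
def mapAddHom : KaehlerDifferential f →+ KaehlerDifferential f' :=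
  (map fac).hom.toAddMonoidHom

lemma mapAddHom_smul (b : B) (x : KaehlerDifferential f) :
    mapAddHom fac (b • x) = g' b • mapAddHom fac x :=
  (map fac).hom.map_smul b x

lemma mapAddHom_d (b : B) : mapAddHom fac (d b) = d (g' b) := map_d fac b

end CommRingCat.KaehlerDifferential

lemma CommRingCat.KaehlerDifferential.injective_of_surjective {A B : CommRingCat.{u}} (f : A ⟶ B)
    (h : RingHom.Locally (RingHom.IsStandardSmoothOfRelativeDimension 1) f.hom)
    (F : CommRingCat.KaehlerDifferential f →ₗ[B] B) (hF : Function.Surjective F) :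
    Function.Injective F := by
  let := f.hom.toAlgebra
  exact _root_.KaehlerDifferential.injective_of_surjective h F hF

/-- Through `j` the common image is a copy of `B`, so `F` becomes a surjection onto `B`, to which
`H` applies. -/
lemma LinearMap.injective_of_range_eq {B M N : Type*} [CommRing B] [AddCommGroup M] [AddCommGroup N]
    [Module B M] [Module B N] {j : B →ₗ[B] N} (hj : Function.Injective j) {F : M →ₗ[B] N}
    (h : LinearMap.range F = LinearMap.range j)
    (H : ∀ G : M →ₗ[B] B, Function.Surjective G → Function.Injective G) : Function.Injective F := by
  let e := LinearEquiv.ofInjective j hj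
  let G : M →ₗ[B] B := e.symm.toLinearMap ∘ₗ F.codRestrict _ fun x => h ▸ F.mem_range_self x
  have hG (x : M) : j (G x) = F x := congrArg Subtype.val (e.apply_symm_apply _)
  have hs : Function.Surjective G := fun b => by
    obtain ⟨x, hx⟩ : j b ∈ LinearMap.range F := h ▸ j.mem_range_self b
    exact ⟨x, hj ((hG x).trans hx)⟩
  intro x y hxy
  refine H G hs (hj ?_)
  rw [hG, hG, hxy]

namespace SuperScheme.SplitAtlas

variable {C : SuperScheme.{u}} {S : Scheme.{u}} {f : C.even ⟶ S} (𝒜 : SplitAtlas f)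
  (U : C.bosonic.Opens)

/-- The multiplication of odd functions as a linear map on the exterior square. -/
def wedgeMap : ⋀[Γ(C.bosonic, U)]^2 Γ(𝒜.bundle, U) →ₗ[Γ(C.bosonic, U)] 𝒜.Fn U where
  toFun x := (𝒜.exteriorHom U x).1
  map_add' x y := congrArg Prod.fst (map_add (𝒜.exteriorHom U) x.1 y.1)
  map_smul' r x := by
    have h := (map_smul (𝒜.exteriorHom U) r x.1).trans (Algebra.smul_def r _)
    exact (congrArg Prod.fst h).trans <| (congrArg₂ (· + ·) rfl (zero_oddMul _)).trans (add_zero _)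

lemma wedgeMap_ιMulti (e : Fin 2 → Γ(𝒜.bundle, U)) :
    𝒜.wedgeMap U (exteriorPower.ιMulti _ 2 e) = C.mul _ (toOdd (e 0)) (toOdd (e 1)) := by
  change (𝒜.exteriorHom U _).1 = _
  rw [exteriorPower.ιMulti_apply_coe, ExteriorAlgebra.ιMulti_apply]
  simp only [List.ofFn_succ, List.ofFn_zero, List.prod_cons, List.prod_nil, mul_one, map_mul,
    exteriorHom_ι, oddHom_apply, Sections.mul_fst, Sections.mk_fst, Sections.mk_snd, mul_zero,
    zero_add]
  rfl

variable {U}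

/-- Multiplication by the product of the two elements of a frame. -/
def frameMap (e : Fin 2 → Γ(𝒜.bundle, U)) : Γ(C.bosonic, U) →ₗ[Γ(C.bosonic, U)] 𝒜.Fn U :=
  LinearMap.toSpanSingleton _ _ (C.mul _ (toOdd (e 0)) (toOdd (e 1)) : Γ(C.even, 𝒜.proj ⁻¹ᵁ U))

variable {𝒜}

lemma frameMap_apply (e : Fin 2 → Γ(𝒜.bundle, U)) (r : Γ(C.bosonic, U)) : 𝒜.frameMap e r
    = (𝒜.proj.app U r * C.mul _ (toOdd (e 0)) (toOdd (e 1)) : Γ(C.even, 𝒜.proj ⁻¹ᵁ U)) := rfl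

variable {e : Fin 2 → Γ(𝒜.bundle, U)} (he : IsFrame 𝒜.bundle U e)
include he

lemma frameMap_injective : Function.Injective (𝒜.frameMap e) := by
  intro r s h
  exact 𝒜.proj_app_injective U ((𝒜.isOddFrame_of_isFrame he).ext (𝒜.isBody_proj U r)
    (𝒜.isBody_proj U s) h)

lemma mem_range_frameMap {n : 𝒜.Fn U} :
    n ∈ LinearMap.range (𝒜.frameMap e) ↔ C.bosonicι.app (𝒜.proj ⁻¹ᵁ U) n = 0 := by
  constructor
  · rintro ⟨r, rfl⟩
    rw [frameMap_apply, map_mul, C.isPoint_bosonicι, mul_zero]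
  · intro hn
    obtain ⟨t, ht, h⟩ := (𝒜.isOddFrame_of_isFrame he).exists_eq hn
    obtain ⟨r, rfl⟩ := ht.exists_proj_app_eq
    exact ⟨r, h.symm⟩

lemma range_wedgeMap : LinearMap.range (𝒜.wedgeMap U) = LinearMap.range (𝒜.frameMap e) := by
  have hs := (IsFrame.bijective he).2
  refine le_antisymm ?_ ?_
  · rintro _ ⟨x, rfl⟩
    obtain ⟨r, rfl⟩ := exteriorPower.exists_eq_smul_ιMulti hs x
    rw [map_smul, wedgeMap_ιMulti]
    exact ⟨r, rfl⟩
  · rintro _ ⟨r, rfl⟩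
    refine ⟨r • exteriorPower.ιMulti _ 2 e, ?_⟩
    rw [map_smul, wedgeMap_ιMulti]
    rfl

lemma wedgeMap_injective : Function.Injective (𝒜.wedgeMap U) := by
  rw [injective_iff_map_eq_zero]
  intro x hx
  obtain ⟨r, rfl⟩ := exteriorPower.exists_eq_smul_ιMulti (IsFrame.bijective he).2 x
  rw [map_smul, wedgeMap_ιMulti] at hx
  have h0 : r = 0 := (injective_iff_map_eq_zero _).1 (frameMap_injective he) r hx
  rw [h0, zero_smul]

omit he

variable {V : S.Opens} (hV : U ≤ (C.bosonicι ≫ f) ⁻¹ᵁ V)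

variable (𝒜) in
/-- The linear map on differentials defined by the derivation `∂_z r · θ¹θ²`. -/
def kaehlerMap : CommRingCat.KaehlerDifferential ((C.bosonicι ≫ f).appLE V U hV)
    →ₗ[Γ(C.bosonic, U)] 𝒜.Fn U :=
  (ModuleCat.Derivation.desc (M := ModuleCat.of Γ(C.bosonic, U) (𝒜.Fn U))
    (.mk dvol dvol_add dvol_mul (dvol_base V hV))).hom

lemma kaehlerMap_d (r : Γ(C.bosonic, U)) :
    𝒜.kaehlerMap hV (CommRingCat.KaehlerDifferential.d r) = dvol r :=
  ModuleCat.Derivation.desc_d _ r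

include he in
lemma range_kaehlerMap_le :
    LinearMap.range (𝒜.kaehlerMap hV) ≤ LinearMap.range (𝒜.frameMap e) := by
  rw [LinearMap.range_eq_map, ← CommRingCat.KaehlerDifferential.span_range_d, Submodule.map_span,
    Submodule.span_le]
  rintro _ ⟨_, ⟨r, rfl⟩, rfl⟩
  rw [kaehlerMap_d]
  exact (mem_range_frameMap he).2 (app_dvol r)

-- The coefficients `r` with `r e₀e₁` in the image of the differentials form an ideal `I`, so it is
-- enough that near each point some element of `I` is invertible. In a chart `dz` maps to `θ¹θ²`,
-- but `z` lives only on a basic open set, so its denominator is cleared first.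
include he in
lemma range_frameMap_le (hU : IsAffineOpen U) :
    LinearMap.range (𝒜.frameMap e) ≤ LinearMap.range (𝒜.kaehlerMap hV) := by
  let I : Ideal Γ(C.bosonic, U) := (LinearMap.range (𝒜.kaehlerMap hV)).comap (𝒜.frameMap e)
  suffices hI : I = ⊤ by
    rintro _ ⟨r, rfl⟩
    exact (hI ▸ Submodule.mem_top : r ∈ I)
  rw [← Ideal.span_eq I, ← hU.iSup_basicOpen_eq_self_iff]
  refine le_antisymm (iSup_le fun t => C.bosonic.basicOpen_le _) fun x hx => ?_
  obtain ⟨i, hi⟩ := 𝒜.cover (C.bosonicι x)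
  obtain ⟨g, hgU, hxg⟩ := hU.exists_basicOpen_le (V := C.bosonicι ⁻¹ᵁ 𝒜.U i) ⟨x, hi⟩ hx
  let D := C.bosonic.basicOpen g
  have hD : D ≤ U := C.bosonic.basicOpen_le g
  have hpD : 𝒜.proj ⁻¹ᵁ D ≤ 𝒜.proj ⁻¹ᵁ U := fun y hy => hD hy
  have hDi : 𝒜.proj ⁻¹ᵁ D ≤ 𝒜.U i := fun y hy =>
    (𝒜.proj_preimage (𝒜.U i)).le (show 𝒜.proj y ∈ C.bosonicι ⁻¹ᵁ 𝒜.U i from hgU hy)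
  obtain ⟨z, hz⟩ := ((isBody_iff hDi).2 ((𝒜.φ i).isBody_zOn hDi)).exists_proj_app_eq
  have hloc : IsLocalization.Away g Γ(C.bosonic, D) := hU.isLocalization_basicOpen g
  obtain ⟨n, b, hb⟩ : ∃ (n : ℕ) (b : Γ(C.bosonic, U)),
      C.bosonic.presheaf.map (homOfLE hD).op b
        = C.bosonic.presheaf.map (homOfLE hD).op g ^ n * z := by
    obtain ⟨⟨b, ⟨_, n, rfl⟩⟩, hb⟩ := IsLocalization.surj (Submonoid.powers g) z
    refine ⟨n, b, ?_⟩
    rw [← map_pow, _root_.mul_comm]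
    exact hb.symm
  let d (r : Γ(C.bosonic, U)) :=
    CommRingCat.KaehlerDifferential.d (f := (C.bosonicι ≫ f).appLE V U hV) r
  -- This is the quotient rule with denominators cleared: as `z = b / gⁿ` on `D`, this differential
  -- restricts there to `g²ⁿ dz`.
  obtain ⟨t, ht⟩ := range_kaehlerMap_le he hV ⟨g ^ n • d b - b • d (g ^ n), rfl⟩
  have htI : t ∈ I := ⟨_, ht.symm⟩
  have h1 := congrArg (C.resE hpD) ht
  let ρ := C.bosonic.presheaf.map (homOfLE hD).op
  have hz' : dvol (𝒜 := 𝒜) z = (𝒜.φ i).vol hDi := by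
    have h2 := resE_dvol (𝒜 := 𝒜) z i (𝒜.proj ⁻¹ᵁ D) le_rfl hDi
    rw [resE_self, hz, Coord.dz_zOn, one_mul] at h2
    exact (resE_self _ _).symm.trans h2
  have h2 : C.resE hpD (𝒜.kaehlerMap hV (g ^ n • d b - b • d (g ^ n)))
      = 𝒜.proj.app D (ρ g ^ n * ρ g ^ n) * (𝒜.φ i).vol hDi := by
    rw [map_sub, map_smul, map_smul, kaehlerMap_d, kaehlerMap_d]
    have h3 : C.resE hpD (g ^ n • dvol (𝒜 := 𝒜) b - b • dvol (𝒜 := 𝒜) (g ^ n) : 𝒜.Fn U)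
        = ρ (g ^ n) • dvol (𝒜 := 𝒜) (ρ b) - ρ b • dvol (𝒜 := 𝒜) (ρ (g ^ n)) := by
      rw [dvol_res hD hpD, dvol_res hD hpD]
      refine (resE_sub hpD _ _).trans ?_
      rw [resE_fn_smul, resE_fn_smul, ← proj_app_res hD hpD, ← proj_app_res hD hpD]
      rfl
    rw [h3, show ρ b = ρ g ^ n * z from hb, map_pow, dvol_mul, smul_add, mul_smul,
      add_sub_cancel_right, smul_smul, hz']
    rfl
  have h4 := h1.trans h2
  rw [frameMap_apply, resE_mul, resE_oddMul, ← proj_app_res hD hpD,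
    (𝒜.φ i).oddMul_eq_oddDet hDi 𝒜.rank fun j => C.resO hpD (toOdd (e j)),
    ← _root_.mul_assoc] at h4
  have hb' (r : Γ(C.bosonic, D)) : (𝒜.φ i).IsBody hDi (𝒜.proj.app D r) :=
    (isBody_iff hDi).1 (𝒜.isBody_proj D r)
  have hdet := (𝒜.φ i).isBody_oddDet hDi 𝒜.rank fun j => C.resO hpD (toOdd (e j))
  have h5 := Coord.IsBody.mul_vol_injective ((hb' _).mul hdet) (hb' _) h4
  obtain ⟨δ, hδ⟩ := ((isBody_iff hDi).2 hdet).exists_proj_app_eq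
  rw [← hδ, ← map_mul] at h5
  have h6 : ρ t * δ = ρ g ^ n * ρ g ^ n := 𝒜.proj_app_injective D h5
  -- In `t · δ = g²ⁿ` the right-hand side is a unit on `D`, so `t`, an element of `I`, does not
  -- vanish at `x`.
  have hg : IsUnit (ρ g) := IsLocalization.Away.algebraMap_isUnit g
  have hu : IsUnit (ρ t) := isUnit_of_mul_isUnit_left (h6 ▸ (hg.pow n).mul (hg.pow n))
  have h7 := C.bosonic.basicOpen_of_isUnit hu
  rw [show C.bosonic.basicOpen (ρ t) = D ⊓ C.bosonic.basicOpen t from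
    C.bosonic.basicOpen_res t _] at h7
  exact Opens.mem_iSup.2 ⟨⟨t, htI⟩, (h7.ge hxg).2⟩

lemma range_kaehlerMap (he : IsFrame 𝒜.bundle U e) (hU : IsAffineOpen U) :
    LinearMap.range (𝒜.kaehlerMap hV) = LinearMap.range (𝒜.frameMap e) :=
  le_antisymm (range_kaehlerMap_le he hV) (range_frameMap_le he hV hU)

/-- The image is free of rank one on `e₀e₁`, and a surjection from the differentials of a smooth
curve onto the ring is injective. -/
lemma kaehlerMap_injective [SmoothOfRelativeDimension 1 (C.bosonicι ≫ f)]
    (hU : IsAffineOpen U) (hV' : IsAffineOpen V) (he : IsFrame 𝒜.bundle U e) :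
    Function.Injective (𝒜.kaehlerMap hV) :=
  LinearMap.injective_of_range_eq (frameMap_injective he) (range_kaehlerMap hV he hU)
    (CommRingCat.KaehlerDifferential.injective_of_surjective _
      (HasRingHomProperty.appLE (@SmoothOfRelativeDimension 1) _ ‹_› ⟨V, hV'⟩ ⟨U, hU⟩ hV))

-- Both modules embed into the even functions with the same image, the multiples of `e₀e₁`. The
-- stated equation determines `E` uniquely, so the isomorphism does not depend on the frame.
variable (𝒜) in
lemma exists_detEquiv [SmoothOfRelativeDimension 1 (C.bosonicι ≫ f)]
    (H : IsGoodPair (C.bosonicι ≫ f) 𝒜.bundle U V) :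
    ∃ E : (⋀[Γ(C.bosonic, U)]^2 Γ(𝒜.bundle, U)) ≃ₗ[Γ(C.bosonic, U)]
      CommRingCat.KaehlerDifferential ((C.bosonicι ≫ f).appLE V U H.le),
      ∀ x, 𝒜.kaehlerMap H.le (E x) = 𝒜.wedgeMap U x := by
  obtain ⟨e, he⟩ := H.trivial
  have h : LinearMap.range (𝒜.wedgeMap U) = LinearMap.range (𝒜.kaehlerMap H.le) :=
    (range_wedgeMap he).trans (range_kaehlerMap H.le he H.affU).symm
  let E₁ := LinearEquiv.ofInjective _ (wedgeMap_injective he)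
  let E₂ := LinearEquiv.ofInjective _ (kaehlerMap_injective H.le H.affU H.affV he)
  exact ⟨(E₁.trans (LinearEquiv.ofEq _ _ h)).trans E₂.symm,
    fun x => congrArg Subtype.val (E₂.apply_symm_apply _)⟩

lemma kaehlerMap_map {U' : C.bosonic.Opens} {V' : S.Opens}
    (hV' : U' ≤ (C.bosonicι ≫ f) ⁻¹ᵁ V') (h : U' ≤ U) (h' : V' ≤ V)
    (hp : 𝒜.proj ⁻¹ᵁ U' ≤ 𝒜.proj ⁻¹ᵁ U)
    (ω : CommRingCat.KaehlerDifferential ((C.bosonicι ≫ f).appLE V U hV)) :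
    𝒜.kaehlerMap hV' (CommRingCat.KaehlerDifferential.mapAddHom
      (appLE_res_comm (C.bosonicι ≫ f) hV hV' h h') ω) = C.resE hp (𝒜.kaehlerMap hV ω) := by
  have hω : ω ∈ Submodule.span Γ(C.bosonic, U) (Set.range
      (CommRingCat.KaehlerDifferential.d (f := (C.bosonicι ≫ f).appLE V U hV))) := by
    rw [CommRingCat.KaehlerDifferential.span_range_d]; trivial
  induction hω using Submodule.span_induction with
  | mem ω hω =>
    obtain ⟨r, rfl⟩ := hω
    rw [CommRingCat.KaehlerDifferential.mapAddHom_d, kaehlerMap_d, kaehlerMap_d]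
    exact dvol_res h hp r
  | zero =>
    rw [map_zero, map_zero, map_zero]
    exact (resE_zero hp).symm
  | add x y _ _ hx hy =>
    rw [map_add, map_add, map_add, resE_fn_add, ← hx, ← hy]
    rfl
  | smul r x _ hx =>
    rw [CommRingCat.KaehlerDifferential.mapAddHom_smul, map_smul, map_smul, resE_fn_smul, ← hx,
      ← proj_app_res h hp]
    rfl

variable (𝒜)

/-- The determinant of the bundle of odd functions is the sheaf of differentials. -/
def detIso [SmoothOfRelativeDimension 1 (C.bosonicι ≫ f)] :
    DetIso (C.bosonicι ≫ f) 𝒜.bundle where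
  iso _ _ H := (𝒜.exists_detEquiv H).choose
  iso_res U U' V V' H H' hU hV e := by
    obtain ⟨e', he'⟩ := H'.trivial
    -- Each isomorphism is characterized by its effect on even functions, so compatibility with
    -- restriction can be tested there, where it says that the product of odd functions commutes
    -- with restriction.
    apply kaehlerMap_injective H'.le H'.affU H'.affV he'
    have hp : 𝒜.proj ⁻¹ᵁ U' ≤ 𝒜.proj ⁻¹ᵁ U := fun y hy => hU hy
    refine ((𝒜.exists_detEquiv H').choose_spec _).trans ?_
    refine Eq.trans ?_ (kaehlerMap_map H.le H'.le hU hV hp _).symm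
    rw [(𝒜.exists_detEquiv H).choose_spec, wedgeMap_ιMulti, wedgeMap_ιMulti]
    exact (resE_oddMul hp _ _).symm

end SuperScheme.SplitAtlas

end

theorem mainTheorem2 (k : Type u) [Field k] [CharZero k] (S : Scheme.{u})
    (s : S ⟶ Spec (CommRingCat.of k)) (C : SuperScheme.{u}) (f : C.even ⟶ S)
    (Δ : SuperScheme.BerSection f) (hC : SuperScheme.IsS2Curve f Δ) :
    ∃ (C₀ : Scheme.{u}) (g : C₀ ⟶ S) (E : C₀.Modules),
      SmoothOfRelativeDimension 1 g ∧ IsRankTwoBundle E ∧ Nonempty (DetIso g E) ∧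
      ∃ e : SplitIso C C₀ E, e.p ≫ g = f := by
  obtain ⟨𝒜⟩ := hC.nonempty_splitAtlas s
  have hg : SmoothOfRelativeDimension 1 (C.bosonicι ≫ f) :=
    hC.1.smoothOfRelativeDimension 𝒜.rank
  exact ⟨C.bosonic, C.bosonicι ≫ f, 𝒜.bundle, hg, 𝒜.isRankTwoBundle, ⟨𝒜.detIso⟩, 𝒜.splitIso,
    𝒜.proj_comp⟩
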